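/- For $k\in(0,\sqrt2)$ let $$\Psi_k(z)=\frac{1}{\sqrt{2-k^2}}\,\mathrm{dn}\!\left(\frac{z}{\sqrt{2-k^2}};k\right),$$ where $\mathrm{dn}(u;k)$ is the Jacobi elliptic function of modulus $k$, with $\mathrm{dn}(u;k)=\mathrm{cn}(ku;1/k)$ for $k>1$ (so $\Psi_1=\mathrm{sech}$). For $L>0$ put $p_L(k)=\Psi_k(L)$ and $q_L(k)=\Psi_k'(L)$. (a) For every $L>0$ and $k\in(0,\sqrt2)$, $\Psi_k$ solves $-\Psi''+\Psi-2\Psi^3=0$ on $[0,L]$ with $\Psi'(0)=0$ and $\Psi(0)=1/\sqrt{2-k^2}$. For every $L>0$, the set of all pairs $(\Psi(L),\Psi'(L))$, where $\Psi$ is a real solution of this equation on $[0,L]$ with $\Psi'(0)=0$ and $\Psi(0)>1/\sqrt2$, equals $\{(p_L(k),q_L(k)):k\in(0,\sqrt2)\}$. (b) For every $L>0$ the functions $p_L$ and $q_L$ are $C^1$ on $(0,\sqrt2)$. (c) For every $L>0$ there is a non-empty open interval $(k_-,k_+)\subset(0,\sqrt2)$, where $k_\pm=k_\pm(L)$, such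 that for all $k\in(0,\sqrt2)$: $\Psi_k(z)>0$ and $\Psi_k'(z)<0$ for all $z\in(0,L]$ if and only if $k\in(k_-,k_+)$. As $L\to\infty$, $$k_\pm=1\pm 8e^{-2L}+O(Le^{-4L}).$$ (d) There are constants $C$ and $L_0$ such that for all $L\ge L_0$ and all $k\in(k_-(L),k_+(L))$: $$\left|p_L(k)-\left(2e^{-L}-\tfrac14(k-1)e^{L}\right)\right|\le C L e^{-3L},\qquad \left|q_L(k)-\left(-2e^{-L}-\tfrac14(k-1)e^{L}\right)\right|\le C L e^{-3L},$$ $$\left|\frac{\partial p_L}{\partial k}(k)+\tfrac14e^{L}\right|\le C L e^{-L},\qquad \left|\frac{\partial q_L}{\partial k}(k)+\tfrac14e^{L}\right|\le C L e^{-L}.$$ -/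

import Mathlib

open Set Filter

noncomputable section

/-- The incomplete elliptic integral of the first kind with modulus `k`. -/
def ellipticF (k φ : ℝ) : ℝ :=
  ∫ θ in (0 : ℝ)..φ, 1 / √(1 - k ^ 2 * Real.sin θ ^ 2)

/-- The amplitudes `φ` for which the integrand of `ellipticF k φ` is regular on the whole segment
between `0` and `φ`: the real line if `0 ≤ k < 1`, and the interval `(-π/2, π/2)` if `k = 1`.
For `0 ≤ k ≤ 1` the map `ellipticF k` is an increasing bijection from this set onto `ℝ`. -/
def amplitudeDomain (k : ℝ) : Set ℝ :=
  {φ | ∀ θ ∈ uIcc 0 φ, 0 < 1 - k ^ 2 * Real.sin θ ^ 2}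

/-- The Jacobi amplitude, `0 ≤ k ≤ 1`: the solution `φ` of `ellipticF k φ = u`. -/
def jacobiAm (k u : ℝ) : ℝ :=
  Function.invFunOn (ellipticF k) (amplitudeDomain k) u

/-- The Jacobi elliptic function `cn(u; k)` for `0 ≤ k ≤ 1`. -/
def jacobiCn (k u : ℝ) : ℝ :=
  Real.cos (jacobiAm k u)

/-- The Jacobi elliptic function `dn(u; k)` for `k ≥ 0`. For `k > 1` it is given by the Jacobi real
transformation `dn(u; k) = cn(k u; 1 / k)`. -/
def jacobiDn (k u : ℝ) : ℝ :=
  if k ≤ 1 then √(1 - k ^ 2 * Real.sin (jacobiAm k u) ^ 2) else jacobiCn (1 / k) (k * u)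

/-- The `dn`-family `z ↦ (2 - k²)^(-1/2) dn (z (2 - k²)^(-1/2); k)`, for `0 < k < √2`. -/
def dnSolution (k z : ℝ) : ℝ :=
  1 / √(2 - k ^ 2) * jacobiDn k (z / √(2 - k ^ 2))

/-- The boundary value `Ψ(L)` of the solution `Ψ` of the `dn`-family with parameter `k`. -/
def boundaryValue (L k : ℝ) : ℝ :=
  dnSolution k L

/-- The boundary derivative `Ψ'(L)` of the solution `Ψ` of the `dn`-family with parameter `k`. -/
def boundarySlope (L k : ℝ) : ℝ :=
  deriv (dnSolution k) L

/-- `Ψ`, with first derivative `Φ`, solves `-Ψ'' + Ψ - 2 Ψ³ = 0` on `[0, L]` with the Neumann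
condition `Ψ'(0) = 0`. -/
def IsNeumannSolution (L : ℝ) (Ψ Φ : ℝ → ℝ) : Prop :=
  (∀ z ∈ Icc 0 L, HasDerivWithinAt Ψ (Φ z) (Icc 0 L) z) ∧
  (∀ z ∈ Icc 0 L, HasDerivWithinAt Φ (Ψ z - 2 * Ψ z ^ 3) (Icc 0 L) z) ∧
  Φ 0 = 0

/-- The part of the Dirichlet-to-Neumann manifold of the edge `[0, L]` that is given by the
solutions with `Ψ(0) > 1 / √2`. -/
def dtnBranch (L : ℝ) : Set (ℝ × ℝ) :=
  {x | ∃ Ψ Φ : ℝ → ℝ, IsNeumannSolution L Ψ Φ ∧ 1 / √2 < Ψ 0 ∧ x = (Ψ L, Φ L)}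

/-- The single-bump condition: `Ψ` is positive with negative derivative on `(0, L]`. -/
def IsSingleBump (L : ℝ) (Ψ : ℝ → ℝ) : Prop :=
  ∀ z ∈ Ioc 0 L, 0 < Ψ z ∧ deriv Ψ z < 0

end

/-! ### The Jacobi amplitude -/

/-! The amplitude inverts `ellipticF`, so on both sides of `k = 1` the function `dn` satisfies `dn''
= (2 - k²) dn - 2 dn³`. Rescaling by `a = 1 / √(2 - k²)` turns this into `Ψ'' = Ψ - 2 Ψ³`, with
`Ψ(0) = a` and `Ψ'(0) = 0`. Every `a > 1 / √2` occurs, so uniqueness for the initial value problem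
gives the parametrization (`dtnBranch_eq_image`).

For smoothness in `k`, the linearized equation `w'' = w - 6 Ψ² w` is solved in closed form by
`dnVar`, with the initial data of `∂Ψ/∂k`. A Gronwall bound shows that `dnVar` is the derivative in
`k` and is continuous in `k` (`hasDerivAt_dnSolution_param`, `continuousAt_dnVar_param`). The
formulas for `k ≠ 1` and `k = 1` thus never have to be matched by taking a limit.

A member with `k < 1` stays positive and stops being a single bump at its first minimum. A member
with `k > 1` stops at its first zero. For `k = 1` it never stops. These lengths are monotone in `k`
on each side of `1` (`halfPeriod_mono`, `quarterPeriod_anti`) and continuous there, and single bumps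
persist near `k = 1`. The single-bump parameters therefore form an open interval around `1`.

For large `L`, the estimates are made in the window `|k - 1| ≤ 16 e^(-2L)`. There `Ψ_k` and `dnVar
k` are compared with their explicit counterparts at `k = 1`. General Gronwall constants would be too
large, so the barrier uses a weight whose growth is only a constant times `e^z`; this works because
`6 sech²` is integrable. The outcome is `∂Ψ/∂k = -e^L / 4 + O(L e^(-L))` at `z = L`, and likewise
for the slope. Integrating from `k = 1` expands `p_L` and `q_L`. Their signs at the edges of the
window trap the end points inside it, and the equations `q_L(k₋) = 0` and `p_L(k₊) = 0` then locate
these points (`eventually_bump_expansion`). -/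

lemma amplitudeDomain_of_lt_one {κ : ℝ} (h0 : 0 ≤ κ) (h1 : κ < 1) :
    amplitudeDomain κ = univ := by
  refine eq_univ_of_forall fun φ θ _ => ?_
  have h2 := Real.sin_sq_le_one θ
  have h3 : κ ^ 2 < 1 := by nlinarith
  nlinarith [sq_nonneg (Real.sin θ), sq_nonneg κ]

lemma amplitudeDomain_one : amplitudeDomain 1 = Ioo (-(Real.pi / 2)) (Real.pi / 2) := by
  have hpi := Real.pi_pos
  ext φ
  constructor
  · intro h
    constructor
    · by_contra! hc
      have := h (-(Real.pi / 2)) (mem_uIcc.2 (Or.inr ⟨hc, by linarith⟩))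
      simp at this
    · by_contra! hc
      have := h (Real.pi / 2) (mem_uIcc.2 (Or.inl ⟨by linarith, hc⟩))
      simp at this
  · rintro ⟨h1, h2⟩ θ hθ
    have h3 : -(Real.pi / 2) < θ ∧ θ < Real.pi / 2 := by
      rcases mem_uIcc.1 hθ with h | h <;> constructor <;> linarith [h.1, h.2]
    have := Real.cos_pos_of_mem_Ioo h3
    nlinarith [Real.sin_sq_add_cos_sq θ]

lemma isOpen_amplitudeDomain {κ : ℝ} (h0 : 0 ≤ κ) (h1 : κ ≤ 1) : IsOpen (amplitudeDomain κ) := by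
  rcases h1.lt_or_eq with h | rfl
  · rw [amplitudeDomain_of_lt_one h0 h]; exact isOpen_univ
  · rw [amplitudeDomain_one]; exact isOpen_Ioo

lemma convex_amplitudeDomain {κ : ℝ} (h0 : 0 ≤ κ) (h1 : κ ≤ 1) :
    Convex ℝ (amplitudeDomain κ) := by
  rcases h1.lt_or_eq with h | rfl
  · rw [amplitudeDomain_of_lt_one h0 h]; exact convex_univ
  · rw [amplitudeDomain_one]; exact convex_Ioo _ _

lemma zero_mem_amplitudeDomain (κ : ℝ) : 0 ∈ amplitudeDomain κ := by
  intro θ hθ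
  simp at hθ
  simp [hθ]

/-- Strict differentiability, rather than plain differentiability, is what differentiating the
inverse function `jacobiAm` requires. -/
lemma hasStrictDerivAt_ellipticF {κ φ : ℝ} (hφ : φ ∈ amplitudeDomain κ) :
    HasStrictDerivAt (ellipticF κ) (1 / √(1 - κ ^ 2 * Real.sin φ ^ 2)) φ := by
  have hc : ∀ θ ∈ uIcc 0 φ,
      ContinuousAt (fun θ => 1 / √(1 - κ ^ 2 * Real.sin θ ^ 2)) θ := by
    intro θ hθ
    have := Real.sqrt_pos.2 (hφ θ hθ)
    exact ContinuousAt.div (by fun_prop) (by fun_prop) this.ne'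
  refine intervalIntegral.integral_hasStrictDerivAt_right
    (ContinuousOn.intervalIntegrable fun θ hθ => (hc θ hθ).continuousWithinAt) ?_
    (hc φ right_mem_uIcc)
  exact (Measurable.stronglyMeasurable (by fun_prop)).stronglyMeasurableAtFilter

lemma strictMonoOn_ellipticF {κ : ℝ} (h0 : 0 ≤ κ) (h1 : κ ≤ 1) :
    StrictMonoOn (ellipticF κ) (amplitudeDomain κ) := by
  refine strictMonoOn_of_deriv_pos (convex_amplitudeDomain h0 h1)
    (fun φ hφ => (hasStrictDerivAt_ellipticF hφ).hasDerivAt.continuousAt.continuousWithinAt) ?_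
  intro φ hφ
  have hφ := interior_subset hφ
  rw [(hasStrictDerivAt_ellipticF hφ).hasDerivAt.deriv]
  exact one_div_pos.2 (Real.sqrt_pos.2 (hφ φ right_mem_uIcc))

@[simp] lemma ellipticF_zero (κ : ℝ) : ellipticF κ 0 = 0 := by simp [ellipticF]

lemma cos_arctan_sinh (u : ℝ) : Real.cos (Real.arctan (Real.sinh u)) = 1 / Real.cosh u := by
  rw [Real.cos_arctan, ← Real.cosh_sq', Real.sqrt_sq (Real.cosh_pos u).le]

/-- Both sides vanish at `0`, and the difference has zero derivative because `1 - sin²` at the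
Gudermannian angle is `sech²`. -/
lemma ellipticF_one_arctan_sinh (u : ℝ) : ellipticF 1 (Real.arctan (Real.sinh u)) = u := by
  have hmem : ∀ x, Real.arctan (Real.sinh x) ∈ amplitudeDomain 1 := fun x => by
    rw [amplitudeDomain_one]
    exact ⟨Real.neg_pi_div_two_lt_arctan _, Real.arctan_lt_pi_div_two _⟩
  have hd : ∀ x, HasDerivAt (fun x => ellipticF 1 (Real.arctan (Real.sinh x)) - x) 0 x := by
    intro x
    have h1 := (hasStrictDerivAt_ellipticF (hmem x)).hasDerivAt
    have h2 := (Real.hasDerivAt_sinh x).arctan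
    have h3 := (h1.comp x h2).sub (hasDerivAt_id x)
    refine h3.congr_deriv ?_
    have hc := Real.cosh_pos x
    have h4 : 1 - (1 : ℝ) ^ 2 * Real.sin (Real.arctan (Real.sinh x)) ^ 2
        = (1 / Real.cosh x) ^ 2 := by
      rw [← cos_arctan_sinh, Real.cos_sq']; ring
    rw [h4, Real.sqrt_sq (by positivity), ← Real.cosh_sq']
    field_simp
    simp
  have := is_const_of_deriv_eq_zero (fun x => (hd x).differentiableAt) (fun x => (hd x).deriv) u 0
  simp at this
  linarith

lemma surjOn_ellipticF {κ : ℝ} (h0 : 0 ≤ κ) (h1 : κ ≤ 1) (u : ℝ) :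
    ∃ φ ∈ amplitudeDomain κ, ellipticF κ φ = u := by
  rcases h1.lt_or_eq with h | rfl
  · have hD := amplitudeDomain_of_lt_one h0 h
    have hmem : ∀ φ, φ ∈ amplitudeDomain κ := fun φ => hD ▸ mem_univ φ
    have hder := fun φ => (hasStrictDerivAt_ellipticF (hmem φ)).hasDerivAt
    -- The integrand is at least `1`, so `ellipticF κ` outgrows the identity and its values at
    -- `±|u|` enclose `u`.
    have hmono : Monotone fun φ => ellipticF κ φ - φ := by
      refine monotone_of_deriv_nonneg
        (fun φ => ((hder φ).sub (hasDerivAt_id φ)).differentiableAt) fun φ => ?_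
      have : HasDerivAt (fun φ => ellipticF κ φ - φ) _ φ := (hder φ).sub (hasDerivAt_id φ)
      rw [this.deriv, sub_nonneg]
      have hp := hmem φ φ right_mem_uIcc
      rw [le_div_iff₀ (Real.sqrt_pos.2 hp), one_mul]
      exact Real.sqrt_le_one.2 (by nlinarith [sq_nonneg (κ * Real.sin φ)])
    have hcont : Continuous (ellipticF κ) :=
      continuous_iff_continuousAt.2 fun φ => (hder φ).continuousAt
    have ha := hmono (neg_nonpos.2 (abs_nonneg u))
    have hb := hmono (abs_nonneg u)
    simp only [ellipticF_zero] at ha hb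
    have := intermediate_value_Icc (neg_le_self (abs_nonneg u)) hcont.continuousOn
      (a := -|u|) (b := |u|) (f := ellipticF κ)
      (show u ∈ _ from ⟨by linarith [neg_abs_le u], by linarith [le_abs_self u]⟩)
    obtain ⟨φ, -, hφ⟩ := this
    exact ⟨φ, hmem φ, hφ⟩
  · refine ⟨_, ?_, ellipticF_one_arctan_sinh u⟩
    rw [amplitudeDomain_one]
    exact ⟨Real.neg_pi_div_two_lt_arctan _, Real.arctan_lt_pi_div_two _⟩

lemma jacobiAm_mem {κ : ℝ} (h0 : 0 ≤ κ) (h1 : κ ≤ 1) (u : ℝ) :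
    jacobiAm κ u ∈ amplitudeDomain κ :=
  Function.invFunOn_mem (surjOn_ellipticF h0 h1 u)

lemma ellipticF_jacobiAm {κ : ℝ} (h0 : 0 ≤ κ) (h1 : κ ≤ 1) (u : ℝ) :
    ellipticF κ (jacobiAm κ u) = u :=
  Function.invFunOn_eq (surjOn_ellipticF h0 h1 u)

lemma jacobiAm_ellipticF {κ φ : ℝ} (h0 : 0 ≤ κ) (h1 : κ ≤ 1) (hφ : φ ∈ amplitudeDomain κ) :
    jacobiAm κ (ellipticF κ φ) = φ :=
  (strictMonoOn_ellipticF h0 h1).injOn (jacobiAm_mem h0 h1 _) hφ (ellipticF_jacobiAm h0 h1 _)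

lemma jacobiAm_lt_iff {κ u φ : ℝ} (h0 : 0 ≤ κ) (h1 : κ ≤ 1) (hφ : φ ∈ amplitudeDomain κ) :
    jacobiAm κ u < φ ↔ u < ellipticF κ φ := by
  rw [← (strictMonoOn_ellipticF h0 h1).lt_iff_lt (jacobiAm_mem h0 h1 u) hφ,
    ellipticF_jacobiAm h0 h1]

lemma lt_jacobiAm_iff {κ u φ : ℝ} (h0 : 0 ≤ κ) (h1 : κ ≤ 1) (hφ : φ ∈ amplitudeDomain κ) :
    φ < jacobiAm κ u ↔ ellipticF κ φ < u := by
  rw [← (strictMonoOn_ellipticF h0 h1).lt_iff_lt hφ (jacobiAm_mem h0 h1 u),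
    ellipticF_jacobiAm h0 h1]

@[simp] lemma jacobiAm_zero {κ : ℝ} (h0 : 0 ≤ κ) (h1 : κ ≤ 1) : jacobiAm κ 0 = 0 := by
  simpa using jacobiAm_ellipticF h0 h1 (zero_mem_amplitudeDomain κ)

lemma jacobiAm_pos {κ u : ℝ} (h0 : 0 ≤ κ) (h1 : κ ≤ 1) (hu : 0 < u) : 0 < jacobiAm κ u := by
  rw [lt_jacobiAm_iff h0 h1 (zero_mem_amplitudeDomain κ)]; simpa

lemma delta_jacobiAm_pos {κ : ℝ} (h0 : 0 ≤ κ) (h1 : κ ≤ 1) (u : ℝ) :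
    0 < 1 - κ ^ 2 * Real.sin (jacobiAm κ u) ^ 2 :=
  jacobiAm_mem h0 h1 u _ right_mem_uIcc

lemma hasDerivAt_jacobiAm {κ : ℝ} (h0 : 0 ≤ κ) (h1 : κ ≤ 1) (u : ℝ) :
    HasDerivAt (jacobiAm κ) (√(1 - κ ^ 2 * Real.sin (jacobiAm κ u) ^ 2)) u := by
  have hm := jacobiAm_mem h0 h1 u
  have hs := hasStrictDerivAt_ellipticF hm
  have hne : 1 / √(1 - κ ^ 2 * Real.sin (jacobiAm κ u) ^ 2) ≠ 0 :=
    (one_div_pos.2 (Real.sqrt_pos.2 (delta_jacobiAm_pos h0 h1 u))).ne'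
  have h := hs.to_local_left_inverse hne (g := jacobiAm κ) ?_
  · rw [ellipticF_jacobiAm h0 h1] at h
    simpa using h.hasDerivAt
  · filter_upwards [(isOpen_amplitudeDomain h0 h1).mem_nhds hm] with φ hφ
    exact jacobiAm_ellipticF h0 h1 hφ

lemma jacobiAm_one (u : ℝ) : jacobiAm 1 u = Real.arctan (Real.sinh u) := by
  have hmem : Real.arctan (Real.sinh u) ∈ amplitudeDomain 1 := by
    rw [amplitudeDomain_one]
    exact ⟨Real.neg_pi_div_two_lt_arctan _, Real.arctan_lt_pi_div_two _⟩
  simpa [ellipticF_one_arctan_sinh] using jacobiAm_ellipticF zero_le_one le_rfl hmem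

/-! ### The function `dn` -/

/-- The derivative of `u ↦ jacobiDn k u`. -/
noncomputable def jacobiDnSlope (k u : ℝ) : ℝ :=
  if k ≤ 1 then -k ^ 2 * (Real.sin (jacobiAm k u) * Real.cos (jacobiAm k u))
  else -k * Real.sin (jacobiAm (1 / k) (k * u)) *
    √(1 - (1 / k) ^ 2 * Real.sin (jacobiAm (1 / k) (k * u)) ^ 2)

lemma hasDerivAt_sqrt_delta {κ : ℝ} (h0 : 0 ≤ κ) (h1 : κ ≤ 1) (u : ℝ) :
    HasDerivAt (fun u => √(1 - κ ^ 2 * Real.sin (jacobiAm κ u) ^ 2))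
      (-κ ^ 2 * (Real.sin (jacobiAm κ u) * Real.cos (jacobiAm κ u))) u := by
  have h := hasDerivAt_jacobiAm h0 h1 u
  have hp := delta_jacobiAm_pos h0 h1 u
  have h2 := (((h.sin.pow 2).const_mul (κ ^ 2)).const_sub 1).sqrt hp.ne'
  refine h2.congr_deriv ?_
  have := Real.sqrt_pos.2 hp
  simp only [Pi.pow_apply]
  field_simp
  push_cast
  ring

lemma hasDerivAt_jacobiDn {k : ℝ} (hk : 0 < k) (u : ℝ) :
    HasDerivAt (jacobiDn k) (jacobiDnSlope k u) u := by
  by_cases h1 : k ≤ 1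
  · have : jacobiDn k = fun u => √(1 - k ^ 2 * Real.sin (jacobiAm k u) ^ 2) := by
      funext u; simp [jacobiDn, h1]
    rw [this]
    simpa [jacobiDnSlope, h1] using hasDerivAt_sqrt_delta hk.le h1 u
  · have : jacobiDn k = fun u => Real.cos (jacobiAm (1 / k) (k * u)) := by
      funext u; simp [jacobiDn, jacobiCn, h1]
    rw [this]
    have h2 : 1 / k ≤ 1 := by rw [div_le_one hk]; linarith
    have h := ((hasDerivAt_jacobiAm (by positivity) h2 (k * u)).comp u
      ((hasDerivAt_id u).const_mul k)).cos
    refine h.congr_deriv ?_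
    simp [jacobiDnSlope, h1]
    ring

lemma hasDerivAt_jacobiDnSlope {k : ℝ} (hk : 0 < k) (u : ℝ) :
    HasDerivAt (jacobiDnSlope k) ((2 - k ^ 2) * jacobiDn k u - 2 * jacobiDn k u ^ 3) u := by
  by_cases h1 : k ≤ 1
  · have : jacobiDnSlope k
        = fun u => -k ^ 2 * (Real.sin (jacobiAm k u) * Real.cos (jacobiAm k u)) := by
      funext u; simp [jacobiDnSlope, h1]
    rw [this]
    have h := hasDerivAt_jacobiAm hk.le h1 u
    refine ((h.sin.mul h.cos).const_mul (-k ^ 2)).congr_deriv ?_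
    simp only [jacobiDn, h1, if_true]
    have hp := delta_jacobiAm_pos hk.le h1 u
    set φ := jacobiAm k u
    have hs := Real.sq_sqrt hp.le
    set y := √(1 - k ^ 2 * Real.sin φ ^ 2)
    have hc := Real.cos_sq' φ
    have : y ^ 3 = y * (1 - k ^ 2 * Real.sin φ ^ 2) := by rw [← hs]; ring
    rw [this]
    linear_combination (-k ^ 2 * y) * hc
  · have : jacobiDnSlope k = fun u => -k * Real.sin (jacobiAm (1 / k) (k * u)) *
        √(1 - (1 / k) ^ 2 * Real.sin (jacobiAm (1 / k) (k * u)) ^ 2) := by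
      funext u; simp [jacobiDnSlope, h1]
    rw [this]
    have h2 : 1 / k ≤ 1 := by rw [div_le_one hk]; linarith
    have h3 : 0 ≤ 1 / k := by positivity
    have hlin : HasDerivAt (fun u => k * u) (k * 1) u := (hasDerivAt_id u).const_mul k
    have ha := ((hasDerivAt_jacobiAm h3 h2 (k * u)).comp u hlin).sin.const_mul (-k)
    have hb := (hasDerivAt_sqrt_delta h3 h2 (k * u)).comp u hlin
    refine (ha.mul hb).congr_deriv ?_
    simp only [jacobiDn, jacobiCn, h1, if_false, Function.comp]
    have hp := delta_jacobiAm_pos h3 h2 (k * u)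
    set φ := jacobiAm (1 / k) (k * u)
    have hs := Real.sq_sqrt hp.le
    set y := √(1 - (1 / k) ^ 2 * Real.sin φ ^ 2)
    have hc := Real.sin_sq φ
    have e : -k * (Real.cos φ * (y * (k * 1))) * y
        = -k ^ 2 * Real.cos φ * (1 - (1 / k) ^ 2 * Real.sin φ ^ 2) := by
      rw [← hs]; ring
    rw [e]
    field_simp
    rw [hc]
    ring

@[simp] lemma jacobiDn_zero {k : ℝ} (hk : 0 < k) : jacobiDn k 0 = 1 := by
  by_cases h1 : k ≤ 1
  · simp [jacobiDn, h1, jacobiAm_zero hk.le h1]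
  · have h2 : 1 / k ≤ 1 := by rw [div_le_one hk]; linarith
    have := jacobiAm_zero (by positivity) h2
    simp only [one_div] at this
    simp [jacobiDn, jacobiCn, h1, this]

@[simp] lemma jacobiDnSlope_zero {k : ℝ} (hk : 0 < k) : jacobiDnSlope k 0 = 0 := by
  by_cases h1 : k ≤ 1
  · simp [jacobiDnSlope, h1, jacobiAm_zero hk.le h1]
  · have h2 : 1 / k ≤ 1 := by rw [div_le_one hk]; linarith
    have := jacobiAm_zero (by positivity) h2
    simp only [one_div] at this
    simp [jacobiDnSlope, h1, this]

lemma abs_jacobiDn_le_one (k u : ℝ) : |jacobiDn k u| ≤ 1 := by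
  by_cases h1 : k ≤ 1
  · simp only [jacobiDn, h1, if_true]
    rw [abs_of_nonneg (Real.sqrt_nonneg _)]
    exact Real.sqrt_le_one.2 (by nlinarith [sq_nonneg (k * Real.sin (jacobiAm k u))])
  · simp only [jacobiDn, h1, if_false, jacobiCn]
    exact Real.abs_cos_le_one _

/-! ### The `dn`-family -/

/-- The initial value `Ψ(0)` of the member of the `dn`-family with parameter `k`. -/
noncomputable def dnAmplitude (k : ℝ) : ℝ := 1 / √(2 - k ^ 2)

/-- The derivative of `z ↦ dnSolution k z`. -/
noncomputable def dnSlope (k z : ℝ) : ℝ :=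
  dnAmplitude k ^ 2 * jacobiDnSlope k (dnAmplitude k * z)

lemma two_sub_sq_pos {k : ℝ} (hk : k ∈ Ioo 0 √2) : 0 < 2 - k ^ 2 := by
  have := Real.sq_sqrt (show (0 : ℝ) ≤ 2 by norm_num)
  nlinarith [hk.1, hk.2]

lemma mem_Ioo_sqrt_two {k : ℝ} (h0 : 0 < k) (h : k ^ 2 < 2) : k ∈ Ioo 0 √2 :=
  ⟨h0, Real.lt_sqrt_of_sq_lt h⟩

lemma dnAmplitude_pos {k : ℝ} (hk : k ∈ Ioo 0 √2) : 0 < dnAmplitude k :=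
  one_div_pos.2 (Real.sqrt_pos.2 (two_sub_sq_pos hk))

lemma dnAmplitude_sq {k : ℝ} (hk : k ∈ Ioo 0 √2) : dnAmplitude k ^ 2 * (2 - k ^ 2) = 1 := by
  have := two_sub_sq_pos hk
  rw [dnAmplitude, div_pow, Real.sq_sqrt this.le]
  field_simp

lemma dnSolution_eq (k z : ℝ) :
    dnSolution k z = dnAmplitude k * jacobiDn k (dnAmplitude k * z) := by
  rw [dnSolution, dnAmplitude]
  congr 2
  ring

lemma hasDerivAt_dnSolution {k : ℝ} (hk : k ∈ Ioo 0 √2) (z : ℝ) :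
    HasDerivAt (dnSolution k) (dnSlope k z) z := by
  rw [show dnSolution k = fun z => dnAmplitude k * jacobiDn k (dnAmplitude k * z) from
    funext (dnSolution_eq k)]
  have hlin : HasDerivAt (fun z => dnAmplitude k * z) (dnAmplitude k * 1) z :=
    (hasDerivAt_id z).const_mul _
  refine (((hasDerivAt_jacobiDn hk.1 _).comp z hlin).const_mul _).congr_deriv ?_
  rw [dnSlope]; ring

lemma hasDerivAt_dnSlope {k : ℝ} (hk : k ∈ Ioo 0 √2) (z : ℝ) :
    HasDerivAt (dnSlope k) (dnSolution k z - 2 * dnSolution k z ^ 3) z := by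
  have hlin : HasDerivAt (fun z => dnAmplitude k * z) (dnAmplitude k * 1) z :=
    (hasDerivAt_id z).const_mul _
  refine (((hasDerivAt_jacobiDnSlope hk.1 _).comp z hlin).const_mul _).congr_deriv ?_
  rw [dnSolution_eq]
  set y := jacobiDn k (dnAmplitude k * z)
  linear_combination (dnAmplitude k * y) * dnAmplitude_sq hk

lemma deriv_dnSolution {k : ℝ} (hk : k ∈ Ioo 0 √2) : deriv (dnSolution k) = dnSlope k :=
  funext fun z => (hasDerivAt_dnSolution hk z).deriv

lemma dnSolution_zero {k : ℝ} (hk : k ∈ Ioo 0 √2) : dnSolution k 0 = dnAmplitude k := by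
  rw [dnSolution_eq]; simp [jacobiDn_zero hk.1]

lemma dnSlope_zero {k : ℝ} (hk : k ∈ Ioo 0 √2) : dnSlope k 0 = 0 := by
  simp [dnSlope, jacobiDnSlope_zero hk.1]

lemma abs_dnSolution_le {k : ℝ} (hk : k ∈ Ioo 0 √2) (z : ℝ) :
    |dnSolution k z| ≤ dnAmplitude k := by
  rw [dnSolution_eq, abs_mul, abs_of_pos (dnAmplitude_pos hk)]
  exact mul_le_of_le_one_right (dnAmplitude_pos hk).le (abs_jacobiDn_le_one _ _)

lemma one_mem_Ioo_sqrt_two : (1 : ℝ) ∈ Ioo 0 √2 := mem_Ioo_sqrt_two one_pos (by norm_num)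

lemma dnAmplitude_one : dnAmplitude 1 = 1 := by norm_num [dnAmplitude]

lemma dnSolution_one (z : ℝ) : dnSolution 1 z = 1 / Real.cosh z := by
  have h := Real.cos_sq' (jacobiAm 1 z)
  rw [dnSolution_eq, dnAmplitude_one, one_mul, one_mul, jacobiDn, if_pos le_rfl, one_pow, one_mul,
    ← h, jacobiAm_one, cos_arctan_sinh, Real.sqrt_sq (one_div_nonneg.2 (Real.cosh_pos z).le)]

lemma dnSlope_one (z : ℝ) : dnSlope 1 z = -(Real.sinh z / Real.cosh z ^ 2) := by
  have h := ((Real.hasDerivAt_cosh z).inv (Real.cosh_pos z).ne')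
  have h2 := hasDerivAt_dnSolution one_mem_Ioo_sqrt_two z
  rw [show dnSolution 1 = fun z => (Real.cosh z)⁻¹ from
    funext fun z => by rw [dnSolution_one, one_div]] at h2
  rw [h2.unique h]
  ring

/-! ### Uniqueness and the parametrization of the Dirichlet-to-Neumann branch. -/

lemma isNeumannSolution_dnSolution {k : ℝ} (hk : k ∈ Ioo 0 √2) (L : ℝ) :
    IsNeumannSolution L (dnSolution k) (dnSlope k) :=
  ⟨fun z _ => (hasDerivAt_dnSolution hk z).hasDerivWithinAt,
    fun z _ => (hasDerivAt_dnSlope hk z).hasDerivWithinAt, dnSlope_zero hk⟩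

lemma IsNeumannSolution.unique {L : ℝ} (hL : 0 ≤ L) {Ψ₁ Φ₁ Ψ₂ Φ₂ : ℝ → ℝ}
    (h₁ : IsNeumannSolution L Ψ₁ Φ₁) (h₂ : IsNeumannSolution L Ψ₂ Φ₂) (h0 : Ψ₁ 0 = Ψ₂ 0) :
    Ψ₁ L = Ψ₂ L ∧ Φ₁ L = Φ₂ L := by
  let v : ℝ → ℝ × ℝ → ℝ × ℝ := fun _ x => (x.2, x.1 - 2 * x.1 ^ 3)
  have hcont : ∀ {Ψ Φ : ℝ → ℝ}, IsNeumannSolution L Ψ Φ →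
      ContinuousOn (fun z => (Ψ z, Φ z)) (Icc 0 L) := fun h z hz =>
    ((h.1 z hz).continuousWithinAt).prodMk ((h.2.1 z hz).continuousWithinAt)
  have hder : ∀ {Ψ Φ : ℝ → ℝ}, IsNeumannSolution L Ψ Φ → ∀ z ∈ Ico 0 L,
      HasDerivWithinAt (fun z => (Ψ z, Φ z)) (v z (Ψ z, Φ z)) (Ici z) z := by
    intro Ψ Φ h z hz
    have hz' := Ico_subset_Icc_self hz
    refine ((h.1 z hz').prodMk (h.2.1 z hz')).mono_of_mem_nhdsWithin ?_
    exact mem_of_superset (Icc_mem_nhdsGE hz.2) (Icc_subset_Icc_left hz.1)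
  -- The cubic field is only locally Lipschitz, so both trajectories are first confined to one
  -- closed ball.
  obtain ⟨M, hM⟩ := ((isCompact_Icc.image_of_continuousOn (hcont h₁)).isBounded.union
    (isCompact_Icc.image_of_continuousOn (hcont h₂)).isBounded).subset_closedBall 0
  have hv : ContDiff ℝ 1 (v 0) := by fun_prop
  obtain ⟨K, hK⟩ := (hv.contDiffOn (s := Metric.closedBall 0 M)).exists_lipschitzOnWith
    one_ne_zero (convex_closedBall 0 M) (isCompact_closedBall 0 M)
  have := ODE_solution_unique_of_mem_Icc_right (v := v) (s := fun _ => Metric.closedBall 0 M)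
    (fun _ _ => hK) (hcont h₁) (hder h₁)
    (fun z hz => hM (Or.inl (mem_image_of_mem _ (Ico_subset_Icc_self hz)))) (hcont h₂) (hder h₂)
    (fun z hz => hM (Or.inr (mem_image_of_mem _ (Ico_subset_Icc_self hz))))
    (by simp [h0, h₁.2.2, h₂.2.2]) (right_mem_Icc.2 hL)
  simpa using this

lemma exists_dnAmplitude_eq {a : ℝ} (ha : 1 / √2 < a) : ∃ k ∈ Ioo 0 √2, dnAmplitude k = a := by
  have h2 : (0 : ℝ) < √2 := by positivity
  have ha0 : 0 < a := (one_div_pos.2 h2).trans ha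
  have h3 : 1 < 2 * a ^ 2 := by
    rw [div_lt_iff₀ h2] at ha
    have := Real.sq_sqrt (show (0 : ℝ) ≤ 2 by norm_num)
    nlinarith
  have h4 : 0 < 2 - 1 / a ^ 2 := by
    rw [sub_pos, div_lt_iff₀ (by positivity)]; exact h3
  have h5 := Real.sq_sqrt h4.le
  have h6 : 0 < 1 / a ^ 2 := by positivity
  refine ⟨√(2 - 1 / a ^ 2), mem_Ioo_sqrt_two (Real.sqrt_pos.2 h4) (by linarith), ?_⟩
  rw [dnAmplitude, h5, sub_sub_cancel, Real.sqrt_div zero_le_one, Real.sqrt_one,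
    Real.sqrt_sq ha0.le, one_div_one_div]

lemma one_div_sqrt_two_lt_dnAmplitude {k : ℝ} (hk : k ∈ Ioo 0 √2) : 1 / √2 < dnAmplitude k := by
  have := two_sub_sq_pos hk
  refine one_div_lt_one_div_of_lt (Real.sqrt_pos.2 this) (Real.sqrt_lt_sqrt this.le ?_)
  nlinarith [hk.1]

lemma dtnBranch_eq_image {L : ℝ} (hL : 0 < L) :
    dtnBranch L = (fun k => (boundaryValue L k, boundarySlope L k)) '' Ioo (0 : ℝ) √2 := by
  ext x
  constructor
  · rintro ⟨Ψ, Φ, hN, h0, rfl⟩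
    obtain ⟨k, hk, hka⟩ := exists_dnAmplitude_eq h0
    obtain ⟨h1, h2⟩ := (isNeumannSolution_dnSolution hk L).unique hL.le hN
      ((dnSolution_zero hk).trans hka)
    exact ⟨k, hk, by simp [boundaryValue, boundarySlope, deriv_dnSolution hk, h1, h2]⟩
  · rintro ⟨k, hk, rfl⟩
    exact ⟨_, _, isNeumannSolution_dnSolution hk L,
      (dnSolution_zero hk).symm ▸ one_div_sqrt_two_lt_dnAmplitude hk,
      by simp [boundaryValue, boundarySlope, deriv_dnSolution hk]⟩

/-! ### Comparison for second-order scalar equations -/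

/-- The sup norm of `(y, y')` cannot cross `B`. At a point of contact both components of its
derivative are smaller than `B'`: the first since `|y'| ≤ B < B'`, the second by `bound`. Since
`bound` may assume `|y z| ≤ B z`, nonlinear bootstrap arguments fit this form. -/
lemma abs_le_barrier {L : ℝ} {y y' y'' B B' : ℝ → ℝ}
    (hy : ∀ z, HasDerivAt y (y' z) z) (hy' : ∀ z, HasDerivAt y' (y'' z) z)
    (hB : ∀ z, HasDerivAt B (B' z) z) (h0 : |y 0| ≤ B 0) (h0' : |y' 0| ≤ B 0)
    (hBB' : ∀ z ∈ Ico 0 L, B z < B' z)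
    (bound : ∀ z ∈ Ico 0 L, |y z| ≤ B z → |y'' z| < B' z) :
    ∀ z ∈ Icc 0 L, |y z| ≤ B z ∧ |y' z| ≤ B z := by
  have hf : ∀ z, HasDerivAt (fun z => (y z, y' z)) (y' z, y'' z) z := fun z =>
    (hy z).prodMk (hy' z)
  have key := image_norm_le_of_norm_deriv_right_lt_deriv_boundary (a := 0) (b := L)
    (fun z _ => (hf z).continuousAt.continuousWithinAt) (fun z _ => (hf z).hasDerivWithinAt)
    (by simpa [Prod.norm_def] using ⟨h0, h0'⟩) hB ?_
  · intro z hz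
    have := key hz
    simpa [Prod.norm_def] using this
  · intro z hz hn
    have h1 : |y z| ≤ B z ∧ |y' z| ≤ B z := by
      have := hn.le
      simpa [Prod.norm_def] using this
    rw [Prod.norm_def]
    exact max_lt (h1.2.trans_lt (hBB' z hz)) (bound z hz h1.1)

/-- Gronwall by way of the barrier `c e^((K + 1) z)`. Taking `c > δ + ε` makes the inequalities
strict, and the extra `1` in the rate absorbs `ε`. -/
lemma abs_le_exp_of_abs_deriv_two_le {L K δ ε : ℝ} {y y' y'' : ℝ → ℝ} (hK : 1 ≤ K)
    (hδ : 0 ≤ δ) (hε : 0 ≤ ε)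
    (hy : ∀ z, HasDerivAt y (y' z) z) (hy' : ∀ z, HasDerivAt y' (y'' z) z)
    (h0 : |y 0| ≤ δ) (h0' : |y' 0| ≤ δ)
    (bound : ∀ z ∈ Icc 0 L, |y'' z| ≤ K * |y z| + ε) :
    ∀ z ∈ Icc 0 L, |y z| ≤ (δ + ε) * Real.exp ((K + 1) * L) ∧
      |y' z| ≤ (δ + ε) * Real.exp ((K + 1) * L) := by
  have main : ∀ c, δ + ε < c → ∀ z ∈ Icc 0 L,
      |y z| ≤ c * Real.exp ((K + 1) * z) ∧ |y' z| ≤ c * Real.exp ((K + 1) * z) := by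
    intro c hc
    have hB : ∀ z, HasDerivAt (fun z => c * Real.exp ((K + 1) * z))
        (c * (Real.exp ((K + 1) * z) * ((K + 1) * 1))) z := fun z =>
      (((hasDerivAt_id z).const_mul (K + 1)).exp).const_mul c
    refine abs_le_barrier hy hy' hB ?_ ?_ ?_ ?_
    · simp; linarith
    · simp; linarith
    · intro z _
      have : 0 < c * Real.exp ((K + 1) * z) := mul_pos (by linarith) (Real.exp_pos _)
      nlinarith
    · intro z hz h
      have h1 := bound z (Ico_subset_Icc_self hz)
      have h2 : 1 ≤ Real.exp ((K + 1) * z) := Real.one_le_exp (mul_nonneg (by linarith) hz.1)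
      have h3 : c ≤ c * Real.exp ((K + 1) * z) := le_mul_of_one_le_right (by linarith) h2
      nlinarith
  intro z hz
  have hexp : Real.exp ((K + 1) * z) ≤ Real.exp ((K + 1) * L) :=
    Real.exp_le_exp.2 (mul_le_mul_of_nonneg_left hz.2 (by linarith))
  -- Let `c` decrease to `δ + ε`.
  have aux : ∀ x, (∀ c, δ + ε < c → x ≤ c * Real.exp ((K + 1) * z)) →
      x ≤ (δ + ε) * Real.exp ((K + 1) * L) := by
    intro x hx
    rw [← div_le_iff₀ (Real.exp_pos _)]
    refine le_of_forall_gt_imp_ge_of_dense fun c hc => ?_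
    rw [div_le_iff₀ (Real.exp_pos _)]
    exact (hx c hc).trans (mul_le_mul_of_nonneg_left hexp (by linarith))
  exact ⟨aux _ fun c hc => (main c hc z hz).1, aux _ fun c hc => (main c hc z hz).2⟩

/-! ### The linearized equation -/

lemma dn_energy {k : ℝ} (hk : k ∈ Ioo 0 √2) (z : ℝ) :
    dnSlope k z ^ 2 = dnSolution k z ^ 2 - dnSolution k z ^ 4
      - (dnAmplitude k ^ 2 - dnAmplitude k ^ 4) := by
  have hd : ∀ z, HasDerivAt
      (fun z => dnSlope k z ^ 2 - dnSolution k z ^ 2 + dnSolution k z ^ 4) 0 z := by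
    intro z
    have h1 := hasDerivAt_dnSolution hk z
    refine ((((hasDerivAt_dnSlope hk z).pow 2).sub (h1.pow 2)).add (h1.pow 4)).congr_deriv ?_
    push_cast
    ring
  have := is_const_of_deriv_eq_zero (fun x => (hd x).differentiableAt) (fun x => (hd x).deriv) z 0
  simp only [dnSolution_zero hk, dnSlope_zero hk] at this
  linarith

/-- The integral of the square of `dnSolution k` over `[0, z]`. -/
noncomputable def dnMass (k z : ℝ) : ℝ := ∫ x in (0 : ℝ)..z, dnSolution k x ^ 2

lemma hasDerivAt_dnMass {k : ℝ} (hk : k ∈ Ioo 0 √2) (z : ℝ) :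
    HasDerivAt (dnMass k) (dnSolution k z ^ 2) z := by
  have hc : Continuous fun x => dnSolution k x ^ 2 :=
    (continuous_iff_continuousAt.2 fun x => (hasDerivAt_dnSolution hk x).continuousAt).pow 2
  exact intervalIntegral.integral_hasDerivAt_right (hc.intervalIntegrable _ _)
    hc.stronglyMeasurable.stronglyMeasurableAtFilter hc.continuousAt

/-- The derivative of `dnSolution k z` with respect to the parameter `k`, in closed form. -/
noncomputable def dnVar (k z : ℝ) : ℝ :=
  if k = 1 then (3 * (dnSolution 1 z + z * dnSlope 1 z) - Real.cosh z) / 2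
  else -(dnAmplitude k ^ 2 / k) *
    ((dnSlope k z * dnMass k z - dnSolution k z ^ 3 + dnSolution k z)
        * (dnAmplitude k ^ 2 - dnAmplitude k ^ 4)⁻¹
      - 2 * (dnSolution k z + z * dnSlope k z))

/-- The derivative of `z ↦ dnVar k z`. -/
noncomputable def dnVarSlope (k z : ℝ) : ℝ :=
  if k = 1 then
    (3 * (2 * dnSlope 1 z + z * (dnSolution 1 z - 2 * dnSolution 1 z ^ 3)) - Real.sinh z) / 2
  else -(dnAmplitude k ^ 2 / k) *
    (((dnSolution k z - 2 * dnSolution k z ^ 3) * dnMass k z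
          - 2 * dnSolution k z ^ 2 * dnSlope k z + dnSlope k z)
        * (dnAmplitude k ^ 2 - dnAmplitude k ^ 4)⁻¹
      - 2 * (2 * dnSlope k z + z * (dnSolution k z - 2 * dnSolution k z ^ 3)))

/-- The energy vanishes only on the homoclinic orbit `a = 1`. This is why `dnVar`, which divides by
the energy, needs a separate formula at `k = 1`. -/
lemma dnAmplitude_energy_ne_zero {k : ℝ} (hk : k ∈ Ioo 0 √2) (h1 : k ≠ 1) :
    dnAmplitude k ^ 2 - dnAmplitude k ^ 4 ≠ 0 := by
  have ha := dnAmplitude_pos hk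
  have hs := dnAmplitude_sq hk
  intro h
  have h2 : dnAmplitude k ^ 2 * (1 - dnAmplitude k ^ 2) = 0 := by linarith
  rcases mul_eq_zero.1 h2 with h3 | h3
  · exact absurd h3 (by positivity)
  · have h4 : dnAmplitude k ^ 2 = 1 := by linarith
    rw [h4, one_mul] at hs
    exact h1 (by nlinarith [hk.1])

lemma hasDerivAt_dnVar {k : ℝ} (hk : k ∈ Ioo 0 √2) (z : ℝ) :
    HasDerivAt (dnVar k) (dnVarSlope k z) z := by
  have hz := hasDerivAt_id z
  by_cases h1 : k = 1
  · subst h1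
    have hΨ := hasDerivAt_dnSolution hk z
    have hΦ := hasDerivAt_dnSlope hk z
    simp only [funext fun z => (show dnVar 1 z = _ from if_pos rfl)]
    refine ((((hΨ.add (hz.mul hΦ)).const_mul 3).sub (Real.hasDerivAt_cosh z)).div_const
      2).congr_deriv ?_
    simp only [dnVarSlope, if_true, id]
    ring
  · have hΨ := hasDerivAt_dnSolution hk z
    have hΦ := hasDerivAt_dnSlope hk z
    simp only [funext fun z => (show dnVar k z = _ from if_neg h1)]
    refine ((((((hΦ.mul (hasDerivAt_dnMass hk z)).sub (hΨ.pow 3)).add hΨ).mul_const _).sub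
      ((hΨ.add (hz.mul hΦ)).const_mul 2)).const_mul _).congr_deriv ?_
    simp only [dnVarSlope, h1, if_false, id]
    push_cast
    ring

/-- Write `𝓛 u = u'' - u + 6 Ψ² u`, `E` for the energy `a² - a⁴` and `m` for `dnMass k`. The scaling
field gives `𝓛(Ψ + z Ψ') = 2 Ψ`. By `dn_energy`, `𝓛(Ψ' m - Ψ³ + Ψ) = 4 E Ψ`. At `k = 1` one has
instead `𝓛 cosh = 6 Ψ`. In each case the combination in `dnVar` cancels the right-hand sides. -/
lemma hasDerivAt_dnVarSlope {k : ℝ} (hk : k ∈ Ioo 0 √2) (z : ℝ) :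
    HasDerivAt (dnVarSlope k) (dnVar k z - 6 * dnSolution k z ^ 2 * dnVar k z) z := by
  have hz := hasDerivAt_id z
  have hen := dn_energy hk z
  by_cases h1 : k = 1
  · subst h1
    have hΨ := hasDerivAt_dnSolution hk z
    have hΦ := hasDerivAt_dnSlope hk z
    simp only [funext fun z => (show dnVarSlope 1 z = _ from if_pos rfl)]
    refine ((((hΦ.const_mul 2).add (hz.mul (hΨ.sub ((hΨ.pow 3).const_mul 2)))).const_mul 3).sub
      (Real.hasDerivAt_sinh z) |>.div_const 2).congr_deriv ?_
    have hc : dnSolution 1 z * Real.cosh z = 1 := by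
      rw [dnSolution_one]; exact one_div_mul_cancel (Real.cosh_pos z).ne'
    simp only [dnVar, if_true, id, Pi.pow_apply, Pi.sub_apply]
    push_cast
    linear_combination (-3 * dnSolution 1 z) * hc
  · have hΨ := hasDerivAt_dnSolution hk z
    have hΦ := hasDerivAt_dnSlope hk z
    simp only [funext fun z => (show dnVarSlope k z = _ from if_neg h1)]
    have hΨ2 := (hΨ.sub ((hΨ.pow 3).const_mul 2))
    refine (((((hΨ2.mul (hasDerivAt_dnMass hk z)).sub (((hΨ.pow 2).const_mul 2).mul hΦ)).add
      hΦ).mul_const _).sub (((hΦ.const_mul 2).add (hz.mul hΨ2)).const_mul 2) |>.const_mul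
      _).congr_deriv ?_
    have hE := mul_inv_cancel₀ (dnAmplitude_energy_ne_zero hk h1)
    simp only [dnVar, h1, if_false, id, Pi.pow_apply, Pi.sub_apply]
    push_cast
    set e := (dnAmplitude k ^ 2 - dnAmplitude k ^ 4)⁻¹
    set c := dnAmplitude k ^ 2 / k
    linear_combination (c * e * 4 * dnSolution k z) * hen - (c * 4 * dnSolution k z) * hE

lemma dnVar_zero {k : ℝ} (hk : k ∈ Ioo 0 √2) : dnVar k 0 = k * dnAmplitude k ^ 3 := by
  by_cases h1 : k = 1
  · subst h1
    norm_num [dnVar, dnSolution_zero hk, dnSlope_zero hk, dnAmplitude_one]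
  · have hE := dnAmplitude_energy_ne_zero hk h1
    have ha := dnAmplitude_pos hk
    have hk0 := hk.1
    have hs := dnAmplitude_sq hk
    simp only [dnVar, h1, if_false, dnSolution_zero hk, dnSlope_zero hk]
    have : (0 * dnMass k 0 - dnAmplitude k ^ 3 + dnAmplitude k)
        * (dnAmplitude k ^ 2 - dnAmplitude k ^ 4)⁻¹ = 1 / dnAmplitude k := by
      rw [← div_eq_mul_inv, div_eq_div_iff hE ha.ne']; ring
    rw [this]
    field_simp
    linear_combination hs

lemma dnVarSlope_zero {k : ℝ} (hk : k ∈ Ioo 0 √2) : dnVarSlope k 0 = 0 := by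
  have : dnMass k 0 = 0 := by simp [dnMass]
  by_cases h1 : k = 1
  · subst h1
    simp [dnVarSlope, dnSlope_zero hk]
  · simp [dnVarSlope, h1, dnSlope_zero hk, this]

/-! ### Dependence on the parameter -/

lemma hasDerivAt_dnAmplitude {k : ℝ} (hk : k ∈ Ioo 0 √2) :
    HasDerivAt dnAmplitude (k * dnAmplitude k ^ 3) k := by
  have h := two_sub_sq_pos hk
  have hs := Real.sqrt_pos.2 h
  have h1 : HasDerivAt (fun k : ℝ => (√(2 - k ^ 2))⁻¹) _ k :=
    (((hasDerivAt_pow 2 k).const_sub 2).sqrt h.ne').inv hs.ne'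
  rw [show dnAmplitude = fun k => (√(2 - k ^ 2))⁻¹ from funext fun k => one_div _]
  refine h1.congr_deriv ?_
  field_simp
  push_cast
  ring

/-- Lipschitz dependence on the initial value: the difference solves a linear equation whose
coefficient is bounded by `1 + 6 A²`. -/
lemma abs_dnSolution_sub_le {L A k l : ℝ} (hk : k ∈ Ioo 0 √2) (hl : l ∈ Ioo 0 √2)
    (hkA : dnAmplitude k ≤ A) (hlA : dnAmplitude l ≤ A) :
    ∀ z ∈ Icc 0 L, |dnSolution k z - dnSolution l z| ≤
      |dnAmplitude k - dnAmplitude l| * Real.exp ((1 + 6 * A ^ 2 + 1) * L) := by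
  have h := abs_le_exp_of_abs_deriv_two_le (L := L) (K := 1 + 6 * A ^ 2) (ε := 0)
    (δ := |dnAmplitude k - dnAmplitude l|) (by nlinarith) (abs_nonneg _) le_rfl
    (fun z => (hasDerivAt_dnSolution hk z).sub (hasDerivAt_dnSolution hl z))
    (fun z => (hasDerivAt_dnSlope hk z).sub (hasDerivAt_dnSlope hl z))
    (by simp [dnSolution_zero hk, dnSolution_zero hl])
    (by simp [dnSlope_zero hk, dnSlope_zero hl]) ?_
  · intro z hz
    simpa using (h z hz).1
  · intro z _
    have h1 := (abs_dnSolution_le hk z).trans hkA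
    have h2 := (abs_dnSolution_le hl z).trans hlA
    simp only [Pi.sub_apply]
    set x := dnSolution k z
    set y := dnSolution l z
    rw [show x - 2 * x ^ 3 - (y - 2 * y ^ 3) = (1 - 2 * (x ^ 2 + x * y + y ^ 2)) * (x - y) by ring,
      abs_mul, add_zero]
    refine mul_le_mul_of_nonneg_right ?_ (abs_nonneg _)
    have h3 := sq_le_sq' (abs_le.1 h1).1 (abs_le.1 h1).2
    have h4 := sq_le_sq' (abs_le.1 h2).1 (abs_le.1 h2).2
    rw [abs_le]
    constructor <;> nlinarith [sq_nonneg (x - y), sq_nonneg (x + y)]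

lemma abs_mul_one_sub_six_sq_le {A x e : ℝ} (h : |x| ≤ A) :
    |e - 6 * x ^ 2 * e| ≤ (1 + 6 * A ^ 2) * |e| := by
  rw [show e - 6 * x ^ 2 * e = (1 - 6 * x ^ 2) * e by ring, abs_mul]
  refine mul_le_mul_of_nonneg_right ?_ (abs_nonneg _)
  have h3 := sq_le_sq' (abs_le.1 h).1 (abs_le.1 h).2
  rw [abs_le]
  constructor <;> nlinarith [sq_nonneg x]

lemma eventually_mem_Ioo_and_dnAmplitude_le {k : ℝ} (hk : k ∈ Ioo 0 √2) :
    ∀ᶠ l in nhds k, l ∈ Ioo 0 √2 ∧ dnAmplitude l ≤ dnAmplitude k + 1 := by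
  filter_upwards [Ioo_mem_nhds hk.1 hk.2,
    (hasDerivAt_dnAmplitude hk).continuousAt.eventually (ge_mem_nhds (lt_add_one _))] with l h1 h2
  exact ⟨h1, h2⟩

/-- The Taylor remainder `Ψ_l - Ψ_k - (l - k) w` solves the linearized equation with a source
quadratic in `Ψ_l - Ψ_k`. Its initial value is the Taylor remainder of the amplitude. Gronwall makes
both contributions `o(l - k)`. -/
lemma hasDerivAt_dnSolution_param {k L : ℝ} (hk : k ∈ Ioo 0 √2) (hL : 0 ≤ L) :
    HasDerivAt (fun l => dnSolution l L) (dnVar k L) k ∧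
      HasDerivAt (fun l => dnSlope l L) (dnVarSlope k L) k := by
  set A := dnAmplitude k + 1 with hA
  have hA1 : 1 ≤ A := by linarith [dnAmplitude_pos hk]
  set G := Real.exp ((1 + 6 * A ^ 2 + 1) * L)
  have hG : 0 < G := Real.exp_pos _
  set a' := k * dnAmplitude k ^ 3 with ha'
  have ha := hasDerivAt_dnAmplitude hk
  have key : ∀ᶠ l in nhds k,
      |dnSolution l L - dnSolution k L - (l - k) * dnVar k L| ≤
        (|dnAmplitude l - dnAmplitude k - (l - k) * a'|
          + 10 * A * (|dnAmplitude l - dnAmplitude k| * G) ^ 2) * G ∧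
      |dnSlope l L - dnSlope k L - (l - k) * dnVarSlope k L| ≤
        (|dnAmplitude l - dnAmplitude k - (l - k) * a'|
          + 10 * A * (|dnAmplitude l - dnAmplitude k| * G) ^ 2) * G := by
    filter_upwards [eventually_mem_Ioo_and_dnAmplitude_le hk] with l ⟨hl, hlA⟩
    have hlip := abs_dnSolution_sub_le (L := L) hl hk hlA (by linarith : dnAmplitude k ≤ A)
    refine abs_le_exp_of_abs_deriv_two_le (L := L) (K := 1 + 6 * A ^ 2) (by nlinarith)
      (abs_nonneg _) (by positivity)
      (fun z => ((hasDerivAt_dnSolution hl z).sub (hasDerivAt_dnSolution hk z)).sub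
        ((hasDerivAt_dnVar hk z).const_mul (l - k)))
      (fun z => ((hasDerivAt_dnSlope hl z).sub (hasDerivAt_dnSlope hk z)).sub
        ((hasDerivAt_dnVarSlope hk z).const_mul (l - k)))
      (by simp [dnSolution_zero hk, dnSolution_zero hl, dnVar_zero hk, ha'])
      (by simp [dnSlope_zero hk, dnSlope_zero hl, dnVarSlope_zero hk])
      ?_ L ⟨hL, le_rfl⟩
    intro z hz
    have h1 := (abs_dnSolution_le hl z).trans hlA
    have h2 := (abs_dnSolution_le hk z).trans (by linarith : dnAmplitude k ≤ A)
    have h3 := hlip z hz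
    simp only [Pi.sub_apply]
    set x := dnSolution l z
    set y := dnSolution k z
    set w := dnVar k z
    have e : x - 2 * x ^ 3 - (y - 2 * y ^ 3) - (l - k) * (w - 6 * y ^ 2 * w)
        = ((x - y - (l - k) * w) - 6 * y ^ 2 * (x - y - (l - k) * w))
          - (4 * y + 2 * x) * (x - y) ^ 2 := by ring
    rw [e]
    refine (abs_sub _ _).trans (add_le_add (abs_mul_one_sub_six_sq_le h2) ?_)
    rw [abs_mul, abs_pow]
    refine mul_le_mul ?_ (pow_le_pow_left₀ (abs_nonneg _) h3 2) (by positivity) (by positivity)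
    refine (abs_add_le _ _).trans ?_
    rw [abs_mul, abs_mul, abs_two, abs_of_pos (by norm_num : (0 : ℝ) < 4)]
    linarith
  have ho1 : (fun l => dnAmplitude l - dnAmplitude k - (l - k) * a') =o[nhds k] fun l => l - k := by
    simpa using hasDerivAt_iff_isLittleO.1 ha
  have ho2 : (fun l => 10 * A * (|dnAmplitude l - dnAmplitude k| * G) ^ 2)
      =o[nhds k] fun l => l - k := by
    have hb : (fun l => dnAmplitude l - dnAmplitude k) =O[nhds k] fun l => l - k := ha.isBigO_sub
    have hl : (fun l => dnAmplitude l - dnAmplitude k) =o[nhds k] fun _ => (1 : ℝ) := by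
      refine (Asymptotics.isLittleO_one_iff ℝ).2 ?_
      have := ha.continuousAt.tendsto.sub_const (dnAmplitude k)
      simpa using this
    have := (hb.mul_isLittleO hl).const_mul_left (10 * A * G ^ 2)
    simp only [mul_one] at this
    refine this.congr_left fun l => ?_
    rw [mul_pow, sq_abs]; ring
  have ho : (fun l => (|dnAmplitude l - dnAmplitude k - (l - k) * a'|
      + 10 * A * (|dnAmplitude l - dnAmplitude k| * G) ^ 2) * G) =o[nhds k] fun l => l - k := by
    have := ((ho1.norm_left).add ho2).const_mul_left G
    refine this.congr_left fun l => ?_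
    rw [Real.norm_eq_abs]; ring
  constructor <;> refine hasDerivAt_iff_isLittleO.2 (Asymptotics.IsBigO.trans_isLittleO ?_ ho) <;>
    refine Asymptotics.IsBigO.of_bound 1 ?_ <;> filter_upwards [key] with l h <;>
    rw [one_mul, smul_eq_mul, Real.norm_eq_abs]
  · exact h.1.trans (le_abs_self _)
  · exact h.2.trans (le_abs_self _)

/-- The same Gronwall argument is applied to the difference of two linearized solutions; the source
comes from the change of `Ψ²`. No limit of the closed formulas at `k = 1` is needed. -/
lemma continuousAt_dnVar_param {k L : ℝ} (hk : k ∈ Ioo 0 √2) (hL : 0 ≤ L) :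
    ContinuousAt (fun l => dnVar l L) k ∧ ContinuousAt (fun l => dnVarSlope l L) k := by
  set A := dnAmplitude k + 1 with hA
  have hA1 : 1 ≤ A := by linarith [dnAmplitude_pos hk]
  set G := Real.exp ((1 + 6 * A ^ 2 + 1) * L)
  have hG : 0 < G := Real.exp_pos _
  have ha := (hasDerivAt_dnAmplitude hk).continuousAt
  obtain ⟨M, hM⟩ := isCompact_Icc.exists_bound_of_continuousOn (s := Icc 0 L) (f := dnVar k)
    (fun z _ => (hasDerivAt_dnVar hk z).continuousAt.continuousWithinAt)
  have hM0 : 0 ≤ M := (norm_nonneg _).trans (hM 0 ⟨le_rfl, hL⟩)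
  have key : ∀ᶠ l in nhds k,
      |dnVar l L - dnVar k L| ≤ (|l * dnAmplitude l ^ 3 - k * dnAmplitude k ^ 3|
          + 12 * A * M * (|dnAmplitude l - dnAmplitude k| * G)) * G ∧
      |dnVarSlope l L - dnVarSlope k L| ≤ (|l * dnAmplitude l ^ 3 - k * dnAmplitude k ^ 3|
          + 12 * A * M * (|dnAmplitude l - dnAmplitude k| * G)) * G := by
    filter_upwards [eventually_mem_Ioo_and_dnAmplitude_le hk] with l ⟨hl, hlA⟩
    have hlip := abs_dnSolution_sub_le (L := L) hl hk hlA (by linarith : dnAmplitude k ≤ A)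
    refine abs_le_exp_of_abs_deriv_two_le (L := L) (K := 1 + 6 * A ^ 2) (by nlinarith)
      (abs_nonneg _) (by positivity)
      (fun z => (hasDerivAt_dnVar hl z).sub (hasDerivAt_dnVar hk z))
      (fun z => (hasDerivAt_dnVarSlope hl z).sub (hasDerivAt_dnVarSlope hk z))
      (by simp [dnVar_zero hk, dnVar_zero hl])
      (by simp [dnVarSlope_zero hk, dnVarSlope_zero hl])
      ?_ L ⟨hL, le_rfl⟩
    intro z hz
    have h1 := (abs_dnSolution_le hl z).trans hlA
    have h2 := (abs_dnSolution_le hk z).trans (by linarith : dnAmplitude k ≤ A)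
    have h3 := hlip z hz
    have h4 := hM z hz
    rw [Real.norm_eq_abs] at h4
    simp only [Pi.sub_apply]
    set x := dnSolution l z
    set y := dnSolution k z
    set v := dnVar l z
    set w := dnVar k z
    have e : v - 6 * x ^ 2 * v - (w - 6 * y ^ 2 * w)
        = ((v - w) - 6 * x ^ 2 * (v - w)) - 6 * (x + y) * w * (x - y) := by ring
    rw [e]
    refine (abs_sub _ _).trans (add_le_add (abs_mul_one_sub_six_sq_le h1) ?_)
    rw [abs_mul, abs_mul, abs_mul, abs_of_pos (by norm_num : (0 : ℝ) < 6)]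
    have h5 : |x + y| ≤ 2 * A := (abs_add_le _ _).trans (by linarith)
    have h6 : 6 * |x + y| * |w| ≤ 12 * A * M := by
      have := mul_le_mul h5 h4 (abs_nonneg _) (by positivity)
      linarith
    exact mul_le_mul h6 h3 (abs_nonneg _) (by positivity)
  have hlim : Tendsto (fun l => (|l * dnAmplitude l ^ 3 - k * dnAmplitude k ^ 3|
      + 12 * A * M * (|dnAmplitude l - dnAmplitude k| * G)) * G) (nhds k) (nhds 0) := by
    have hc : ContinuousAt (fun l => (|l * dnAmplitude l ^ 3 - k * dnAmplitude k ^ 3|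
      + 12 * A * M * (|dnAmplitude l - dnAmplitude k| * G)) * G) k := by fun_prop
    simpa using hc.tendsto
  constructor <;> refine tendsto_iff_norm_sub_tendsto_zero.2
    (squeeze_zero' (Eventually.of_forall fun _ => norm_nonneg _) ?_ hlim) <;>
    filter_upwards [key] with l h
  · exact h.1
  · exact h.2

lemma boundarySlope_eq {k : ℝ} (hk : k ∈ Ioo 0 √2) (L : ℝ) :
    boundarySlope L k = dnSlope k L := by
  rw [boundarySlope, deriv_dnSolution hk]

lemma hasDerivAt_boundaryValue {k L : ℝ} (hk : k ∈ Ioo 0 √2) (hL : 0 ≤ L) :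
    HasDerivAt (boundaryValue L) (dnVar k L) k :=
  (hasDerivAt_dnSolution_param hk hL).1

lemma hasDerivAt_boundarySlope {k L : ℝ} (hk : k ∈ Ioo 0 √2) (hL : 0 ≤ L) :
    HasDerivAt (boundarySlope L) (dnVarSlope k L) k := by
  refine (hasDerivAt_dnSolution_param hk hL).2.congr_of_eventuallyEq ?_
  filter_upwards [Ioo_mem_nhds hk.1 hk.2] with l hl
  exact boundarySlope_eq hl L

lemma contDiffOn_one_of_hasDerivAt {f f' : ℝ → ℝ} {s : Set ℝ} (hs : IsOpen s)
    (hf : ∀ x ∈ s, HasDerivAt f (f' x) x) (hf' : ContinuousOn f' s) : ContDiffOn ℝ 1 f s := by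
  rw [show (1 : WithTop ℕ∞) = 0 + 1 by simp, contDiffOn_succ_iff_deriv_of_isOpen hs]
  refine ⟨fun x hx => (hf x hx).differentiableAt.differentiableWithinAt, by simp, ?_⟩
  rw [contDiffOn_zero]
  exact hf'.congr fun x hx => (hf x hx).deriv

lemma contDiffOn_boundaryValue {L : ℝ} (hL : 0 ≤ L) :
    ContDiffOn ℝ 1 (boundaryValue L) (Ioo 0 √2) :=
  contDiffOn_one_of_hasDerivAt isOpen_Ioo (fun _ hk => hasDerivAt_boundaryValue hk hL)
    fun _ hk => (continuousAt_dnVar_param hk hL).1.continuousWithinAt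

lemma contDiffOn_boundarySlope {L : ℝ} (hL : 0 ≤ L) :
    ContDiffOn ℝ 1 (boundarySlope L) (Ioo 0 √2) :=
  contDiffOn_one_of_hasDerivAt isOpen_Ioo (fun _ hk => hasDerivAt_boundarySlope hk hL)
    fun _ hk => (continuousAt_dnVar_param hk hL).2.continuousWithinAt

/-! ### Single-bump solutions -/

lemma pi_div_two_mem_amplitudeDomain {κ : ℝ} (h0 : 0 ≤ κ) (h1 : κ < 1) :
    Real.pi / 2 ∈ amplitudeDomain κ := by
  rw [amplitudeDomain_of_lt_one h0 h1]; exact mem_univ _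

lemma ellipticF_pi_div_two_pos {κ : ℝ} (h0 : 0 ≤ κ) (h1 : κ < 1) :
    0 < ellipticF κ (Real.pi / 2) := by
  have := strictMonoOn_ellipticF h0 h1.le (zero_mem_amplitudeDomain κ)
    (pi_div_two_mem_amplitudeDomain h0 h1) (by positivity)
  simpa using this

lemma jacobiAm_ellipticF_pi_div_two {κ : ℝ} (h0 : 0 ≤ κ) (h1 : κ < 1) :
    jacobiAm κ (ellipticF κ (Real.pi / 2)) = Real.pi / 2 :=
  jacobiAm_ellipticF h0 h1.le (pi_div_two_mem_amplitudeDomain h0 h1)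

lemma sin_cos_jacobiAm_pos {κ u : ℝ} (h0 : 0 ≤ κ) (h1 : κ < 1) (hu : 0 < u)
    (hu' : u < ellipticF κ (Real.pi / 2)) :
    0 < Real.sin (jacobiAm κ u) ∧ 0 < Real.cos (jacobiAm κ u) := by
  have h2 := jacobiAm_pos h0 h1.le hu
  have h3 := (jacobiAm_lt_iff h0 h1.le (pi_div_two_mem_amplitudeDomain h0 h1)).2 hu'
  have := Real.pi_pos
  exact ⟨Real.sin_pos_of_pos_of_lt_pi h2 (by linarith), Real.cos_pos_of_mem_Ioo ⟨by linarith, h3⟩⟩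

/-- For `k < 1`, the distance from `0` to the first minimum of `dnSolution k`. -/
noncomputable def halfPeriod (k : ℝ) : ℝ := √(2 - k ^ 2) * ellipticF k (Real.pi / 2)

/-- For `k > 1`, the distance from `0` to the first zero of `dnSolution k`. -/
noncomputable def quarterPeriod (k : ℝ) : ℝ :=
  √(2 - k ^ 2) * (1 / k * ellipticF (1 / k) (Real.pi / 2))

lemma dnAmplitude_mul_halfPeriod {k : ℝ} (hk : k ∈ Ioo 0 √2) :
    dnAmplitude k * halfPeriod k = ellipticF k (Real.pi / 2) := by
  have := Real.sqrt_pos.2 (two_sub_sq_pos hk)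
  rw [dnAmplitude, halfPeriod]
  field_simp

lemma mul_dnAmplitude_mul_quarterPeriod {k : ℝ} (hk : k ∈ Ioo 0 √2) :
    k * (dnAmplitude k * quarterPeriod k) = ellipticF (1 / k) (Real.pi / 2) := by
  have := Real.sqrt_pos.2 (two_sub_sq_pos hk)
  have := hk.1
  rw [dnAmplitude, quarterPeriod]
  field_simp

lemma halfPeriod_pos {k : ℝ} (hk : k ∈ Ioo 0 √2) (h1 : k < 1) : 0 < halfPeriod k :=
  mul_pos (Real.sqrt_pos.2 (two_sub_sq_pos hk)) (ellipticF_pi_div_two_pos hk.1.le h1)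

lemma quarterPeriod_pos {k : ℝ} (hk : k ∈ Ioo 0 √2) (h1 : 1 < k) : 0 < quarterPeriod k := by
  have h0 := hk.1
  have h2 : 1 / k < 1 := by rwa [div_lt_one h0]
  exact mul_pos (Real.sqrt_pos.2 (two_sub_sq_pos hk))
    (mul_pos (by positivity) (ellipticF_pi_div_two_pos (by positivity) h2))

lemma dnSlope_halfPeriod {k : ℝ} (hk : k ∈ Ioo 0 √2) (h1 : k < 1) :
    dnSlope k (halfPeriod k) = 0 := by
  rw [dnSlope, dnAmplitude_mul_halfPeriod hk, jacobiDnSlope, if_pos h1.le,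
    jacobiAm_ellipticF_pi_div_two hk.1.le h1]
  simp

lemma dnSolution_quarterPeriod {k : ℝ} (hk : k ∈ Ioo 0 √2) (h1 : 1 < k) :
    dnSolution k (quarterPeriod k) = 0 := by
  have h2 : 1 / k < 1 := by rwa [div_lt_one hk.1]
  rw [dnSolution_eq, jacobiDn, if_neg h1.not_ge, jacobiCn, mul_dnAmplitude_mul_quarterPeriod hk,
    jacobiAm_ellipticF_pi_div_two (one_div_nonneg.2 hk.1.le) h2]
  simp

/-- For `k < 1` the solution is positive everywhere, and the slope is a negative multiple of `sin ·
cos` of the amplitude, which first vanishes at `π / 2`. -/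
lemma isSingleBump_iff_lt_halfPeriod {k L : ℝ} (hk : k ∈ Ioo 0 √2) (h1 : k < 1) :
    IsSingleBump L (dnSolution k) ↔ L < halfPeriod k := by
  have ha := dnAmplitude_pos hk
  rw [IsSingleBump, deriv_dnSolution hk]
  constructor
  · intro h
    by_contra! hc
    have := (h _ ⟨halfPeriod_pos hk h1, hc⟩).2
    rw [dnSlope_halfPeriod hk h1] at this
    exact lt_irrefl _ this
  · intro h z hz
    have hu : dnAmplitude k * z < ellipticF k (Real.pi / 2) := by
      rw [← dnAmplitude_mul_halfPeriod hk]
      exact mul_lt_mul_of_pos_left (hz.2.trans_lt h) ha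
    obtain ⟨hs, hc⟩ := sin_cos_jacobiAm_pos hk.1.le h1 (mul_pos ha hz.1) hu
    rw [dnSolution_eq, dnSlope, jacobiDn, jacobiDnSlope, if_pos h1.le, if_pos h1.le]
    have h2 := Real.sqrt_pos.2 (delta_jacobiAm_pos hk.1.le h1.le (dnAmplitude k * z))
    have h3 : 0 < k ^ 2 := pow_pos hk.1 2
    refine ⟨mul_pos ha h2, mul_neg_of_pos_of_neg (pow_pos ha 2) ?_⟩
    rw [neg_mul, neg_lt_zero]
    exact mul_pos h3 (mul_pos hs hc)

/-- For `k > 1` the solution is a multiple of the cosine of the amplitude, so positivity is lost at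
`π / 2`, where the sine in the slope is still positive. -/
lemma isSingleBump_iff_lt_quarterPeriod {k L : ℝ} (hk : k ∈ Ioo 0 √2) (h1 : 1 < k) :
    IsSingleBump L (dnSolution k) ↔ L < quarterPeriod k := by
  have ha := dnAmplitude_pos hk
  have h0 := hk.1
  have h2 : 1 / k < 1 := by rwa [div_lt_one h0]
  have h3 : 0 ≤ 1 / k := by positivity
  rw [IsSingleBump, deriv_dnSolution hk]
  constructor
  · intro h
    by_contra! hc
    have := (h _ ⟨quarterPeriod_pos hk h1, hc⟩).1
    rw [dnSolution_quarterPeriod hk h1] at this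
    exact lt_irrefl _ this
  · intro h z hz
    have hu : k * (dnAmplitude k * z) < ellipticF (1 / k) (Real.pi / 2) := by
      rw [← mul_dnAmplitude_mul_quarterPeriod hk]
      exact mul_lt_mul_of_pos_left (mul_lt_mul_of_pos_left (hz.2.trans_lt h) ha) h0
    obtain ⟨hs, hc⟩ := sin_cos_jacobiAm_pos h3 h2 (mul_pos h0 (mul_pos ha hz.1)) hu
    rw [dnSolution_eq, dnSlope, jacobiDn, jacobiDnSlope, if_neg h1.not_ge, if_neg h1.not_ge,
      jacobiCn]
    have h4 := Real.sqrt_pos.2 (delta_jacobiAm_pos h3 h2.le (k * (dnAmplitude k * z)))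
    refine ⟨mul_pos ha hc, mul_neg_of_pos_of_neg (pow_pos ha 2) ?_⟩
    rw [neg_mul, neg_mul, neg_lt_zero]
    exact mul_pos (mul_pos h0 hs) h4

lemma isSingleBump_one (L : ℝ) : IsSingleBump L (dnSolution 1) := by
  intro z hz
  rw [deriv_dnSolution one_mem_Ioo_sqrt_two, dnSolution_one, dnSlope_one]
  have h1 := Real.cosh_pos z
  have h2 := Real.sinh_pos_iff.2 hz.1
  exact ⟨by positivity, neg_lt_zero.2 (by positivity)⟩

/-! ### Monotonicity and continuity of the periods -/

lemma continuousAt_ellipticF_modulus {κ φ : ℝ} (hφ : φ ∈ Icc 0 (Real.pi / 2))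
    (h : 0 < 1 - κ ^ 2 * Real.sin φ ^ 2) : ContinuousAt (fun κ => ellipticF κ φ) κ := by
  set δ := (1 - κ ^ 2 * Real.sin φ ^ 2) / 2 with hδ
  have hδ0 : 0 < δ := by positivity
  -- Truncating at `δ` makes the integrand continuous for all moduli. Near `κ` the truncation is
  -- inactive, since `sin²` is largest at the end point `φ`.
  have hc : Continuous fun κ : ℝ =>
      ∫ θ in (0 : ℝ)..φ, 1 / √(max δ (1 - κ ^ 2 * Real.sin θ ^ 2)) := by
    refine intervalIntegral.continuous_parametric_intervalIntegral_of_continuous' ?_ 0 φ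
    have : ∀ p : ℝ × ℝ, √(max δ (1 - p.1 ^ 2 * Real.sin p.2 ^ 2)) ≠ 0 := fun p =>
      (Real.sqrt_pos.2 (hδ0.trans_le (le_max_left _ _))).ne'
    exact Continuous.div (by fun_prop) (by fun_prop) this
  refine hc.continuousAt.congr ?_
  have he : ∀ᶠ l in nhds κ, δ < 1 - l ^ 2 * Real.sin φ ^ 2 :=
    ContinuousAt.eventually_lt (by fun_prop) (by fun_prop) (by linarith)
  filter_upwards [he] with l hl
  refine intervalIntegral.integral_congr fun θ hθ => ?_
  rw [uIcc_of_le hφ.1] at hθ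
  have h1 : Real.sin θ ^ 2 ≤ Real.sin φ ^ 2 := by
    refine pow_le_pow_left₀ (Real.sin_nonneg_of_nonneg_of_le_pi hθ.1 ?_)
      (Real.sin_le_sin_of_le_of_le_pi_div_two ?_ hφ.2 hθ.2) 2
    · linarith [hθ.2, hφ.2, Real.pi_pos]
    · linarith [hθ.1, Real.pi_pos]
  have h2 : δ ≤ 1 - l ^ 2 * Real.sin θ ^ 2 := by nlinarith [sq_nonneg l]
  simp only [max_eq_right h2]

lemma continuousAt_ellipticF_pi_div_two {κ : ℝ} (h0 : 0 ≤ κ) (h1 : κ < 1) :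
    ContinuousAt (fun κ => ellipticF κ (Real.pi / 2)) κ := by
  refine continuousAt_ellipticF_modulus ⟨by positivity, le_rfl⟩ ?_
  rw [Real.sin_pi_div_two]
  nlinarith

lemma continuousAt_halfPeriod {k : ℝ} (h0 : 0 ≤ k) (h1 : k < 1) : ContinuousAt halfPeriod k :=
  ContinuousAt.mul (by fun_prop) (continuousAt_ellipticF_pi_div_two h0 h1)

lemma continuousAt_quarterPeriod {k : ℝ} (h1 : 1 < k) : ContinuousAt quarterPeriod k := by
  have h0 : 0 < k := by linarith
  have h2 : 1 / k < 1 := by rwa [div_lt_one h0]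
  have hinv : ContinuousAt (fun k : ℝ => 1 / k) k :=
    continuousAt_const.div continuousAt_id h0.ne'
  have : ContinuousAt (fun k => ellipticF (1 / k) (Real.pi / 2)) k :=
    ContinuousAt.comp (f := fun k : ℝ => 1 / k) (g := fun κ => ellipticF κ (Real.pi / 2))
      (continuousAt_ellipticF_pi_div_two (by positivity) h2) hinv
  exact ContinuousAt.mul (by fun_prop) (hinv.mul this)

lemma continuous_ellipticF_integrand {κ : ℝ} (h0 : 0 ≤ κ) (h1 : κ < 1) :
    Continuous fun θ => 1 / √(1 - κ ^ 2 * Real.sin θ ^ 2) := by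
  have hD := amplitudeDomain_of_lt_one h0 h1
  refine Continuous.div (by fun_prop) (by fun_prop) fun θ => (Real.sqrt_pos.2 ?_).ne'
  exact (hD ▸ mem_univ θ : θ ∈ amplitudeDomain κ) θ right_mem_uIcc

lemma ellipticF_pi_div_two_mono {κ l : ℝ} (h0 : 0 ≤ κ) (hκl : κ ≤ l) (h1 : l < 1) :
    ellipticF κ (Real.pi / 2) ≤ ellipticF l (Real.pi / 2) := by
  have hl := h0.trans hκl
  refine intervalIntegral.integral_mono (by positivity)
    ((continuous_ellipticF_integrand h0 (hκl.trans_lt h1)).intervalIntegrable _ _)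
    ((continuous_ellipticF_integrand hl h1).intervalIntegrable _ _) fun θ => ?_
  have hp : 0 < 1 - l ^ 2 * Real.sin θ ^ 2 :=
    (amplitudeDomain_of_lt_one hl h1 ▸ mem_univ θ : θ ∈ amplitudeDomain l) θ right_mem_uIcc
  refine one_div_le_one_div_of_le (Real.sqrt_pos.2 hp) (Real.sqrt_le_sqrt ?_)
  have := pow_le_pow_left₀ h0 hκl 2
  nlinarith [sq_nonneg (Real.sin θ)]

lemma quarterPeriod_anti {k l : ℝ} (h1 : 1 < k) (hkl : k ≤ l) :
    quarterPeriod l ≤ quarterPeriod k := by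
  have h0 : 0 < k := by linarith
  have hl0 : 0 < l := by linarith
  have h2 : 1 / k < 1 := by rwa [div_lt_one h0]
  have h3 : 1 / l ≤ 1 / k := one_div_le_one_div_of_le h0 hkl
  have h4 := (ellipticF_pi_div_two_pos (κ := 1 / l) (by positivity) (h3.trans_lt h2)).le
  have h5 := ellipticF_pi_div_two_mono (by positivity) h3 h2
  refine mul_le_mul (Real.sqrt_le_sqrt (by nlinarith)) ?_ (by positivity) (Real.sqrt_nonneg _)
  exact mul_le_mul h3 h5 h4 (by positivity)

/-- The radicands add up to `2 - x`, so the square of the left side is `R² + 2 R`, where `R` is `2 -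
x` over the square root of their product. Monotonicity of `R` in `x` comes from a polynomial
identity with the factor `(1 - 2 s)²`. -/
lemma symmetrized_integrand_mono {x y s : ℝ} (h0 : 0 ≤ x) (hxy : x ≤ y) (h1 : y < 1)
    (hs0 : 0 ≤ s) (hs1 : s ≤ 1) :
    √(2 - x) * (1 / √(1 - x * s) + 1 / √(1 - x * (1 - s))) ≤
      √(2 - y) * (1 / √(1 - y * s) + 1 / √(1 - y * (1 - s))) := by
  have aux : ∀ x, 0 ≤ x → x < 1 → 0 < 1 - x * s ∧ 0 < 1 - x * (1 - s) := fun x h h' =>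
    ⟨by nlinarith, by nlinarith⟩
  have hsq : ∀ x, 0 ≤ x → x < 1 →
      (√(2 - x) * (1 / √(1 - x * s) + 1 / √(1 - x * (1 - s)))) ^ 2 =
        ((2 - x) / √((1 - x * s) * (1 - x * (1 - s)))) ^ 2 +
          2 * ((2 - x) / √((1 - x * s) * (1 - x * (1 - s)))) := by
    intro x h h'
    obtain ⟨ha, hb⟩ := aux x h h'
    rw [Real.sqrt_mul ha.le]
    have hT := Real.sq_sqrt (show 0 ≤ 2 - x by linarith)
    have hA := Real.sq_sqrt ha.le
    have hB := Real.sq_sqrt hb.le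
    have hA0 := Real.sqrt_pos.2 ha
    have hB0 := Real.sqrt_pos.2 hb
    set A := √(1 - x * s)
    set B := √(1 - x * (1 - s))
    rw [mul_pow, hT]
    have hAB : A ^ 2 + B ^ 2 = 2 - x := by rw [hA, hB]; ring
    rw [← hAB]
    field_simp
    ring
  have hy0 := h0.trans hxy
  have hx1 := hxy.trans_lt h1
  obtain ⟨ha, hb⟩ := aux x h0 hx1
  obtain ⟨hc, hd⟩ := aux y hy0 h1
  have hP := mul_pos ha hb
  have hQ := mul_pos hc hd
  have hR : (2 - x) / √((1 - x * s) * (1 - x * (1 - s))) ≤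
      (2 - y) / √((1 - y * s) * (1 - y * (1 - s))) := by
    rw [div_le_div_iff₀ (Real.sqrt_pos.2 hP) (Real.sqrt_pos.2 hQ)]
    refine (pow_le_pow_iff_left₀ (mul_nonneg (by linarith) (Real.sqrt_nonneg _))
      (mul_nonneg (by linarith) (Real.sqrt_nonneg _)) two_ne_zero).1 ?_
    rw [mul_pow, mul_pow, Real.sq_sqrt hP.le, Real.sq_sqrt hQ.le, ← sub_nonneg]
    have : (2 - y) ^ 2 * ((1 - x * s) * (1 - x * (1 - s)))
        - (2 - x) ^ 2 * ((1 - y * s) * (1 - y * (1 - s)))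
        = (y - x) * (x + y - x * y) * (1 - 2 * s) ^ 2 := by ring
    rw [this]
    exact mul_nonneg (mul_nonneg (by linarith) (by nlinarith)) (sq_nonneg _)
  have hR0 : 0 ≤ (2 - x) / √((1 - x * s) * (1 - x * (1 - s))) :=
    div_nonneg (by linarith) (Real.sqrt_nonneg _)
  refine (pow_le_pow_iff_left₀ (by positivity) (by positivity) two_ne_zero).1 ?_
  rw [hsq x h0 hx1, hsq y hy0 h1]
  nlinarith

/-- As `k` grows, `√(2 - k²)` falls while the elliptic integral rises. Averaging with the reflection
`θ ↦ π / 2 - θ` produces an integrand that is monotone pointwise. -/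
lemma two_mul_halfPeriod {k : ℝ} (h0 : 0 ≤ k) (h1 : k < 1) :
    2 * halfPeriod k = ∫ θ in (0 : ℝ)..(Real.pi / 2), √(2 - k ^ 2) *
      (1 / √(1 - k ^ 2 * Real.sin θ ^ 2) + 1 / √(1 - k ^ 2 * (1 - Real.sin θ ^ 2))) := by
  have hc := continuous_ellipticF_integrand h0 h1
  have hc' : Continuous fun θ => 1 / √(1 - k ^ 2 * (1 - Real.sin θ ^ 2)) := by
    refine (hc.comp (show Continuous fun θ : ℝ => Real.pi / 2 - θ by fun_prop)).congr fun θ => ?_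
    simp only [Function.comp, Real.sin_pi_div_two_sub, Real.cos_sq']
  have hrefl : ∫ θ in (0 : ℝ)..(Real.pi / 2), 1 / √(1 - k ^ 2 * (1 - Real.sin θ ^ 2))
      = ellipticF k (Real.pi / 2) := by
    have := intervalIntegral.integral_comp_sub_left (a := 0) (b := Real.pi / 2)
      (fun θ => 1 / √(1 - k ^ 2 * Real.sin θ ^ 2)) (Real.pi / 2)
    simp only [sub_self, sub_zero, Real.sin_pi_div_two_sub, Real.cos_sq'] at this
    exact this
  rw [intervalIntegral.integral_const_mul, intervalIntegral.integral_add
    (hc.intervalIntegrable _ _) (hc'.intervalIntegrable _ _), hrefl, halfPeriod]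
  change _ = √(2 - k ^ 2) * (ellipticF k (Real.pi / 2) + _)
  ring

lemma halfPeriod_mono {k l : ℝ} (h0 : 0 ≤ k) (hkl : k ≤ l) (h1 : l < 1) :
    halfPeriod k ≤ halfPeriod l := by
  have key : 2 * halfPeriod k ≤ 2 * halfPeriod l := by
    rw [two_mul_halfPeriod h0 (hkl.trans_lt h1), two_mul_halfPeriod (h0.trans hkl) h1]
    have hc : ∀ k, 0 ≤ k → k < 1 → Continuous fun θ => √(2 - k ^ 2) *
        (1 / √(1 - k ^ 2 * Real.sin θ ^ 2) + 1 / √(1 - k ^ 2 * (1 - Real.sin θ ^ 2))) := by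
      intro k h0 h1
      have hk : k ^ 2 < 1 := by nlinarith
      refine continuous_const.mul ((continuous_ellipticF_integrand h0 h1).add
        (Continuous.div (by fun_prop) (by fun_prop) fun θ => (Real.sqrt_pos.2 ?_).ne'))
      nlinarith [sq_nonneg (Real.sin θ), sq_nonneg k, Real.sin_sq_le_one θ]
    refine intervalIntegral.integral_mono (by positivity)
      ((hc k h0 (hkl.trans_lt h1)).intervalIntegrable _ _)
      ((hc l (h0.trans hkl) h1).intervalIntegrable _ _) fun θ => ?_
    exact symmetrized_integrand_mono (sq_nonneg k) (pow_le_pow_left₀ h0 hkl 2) (by nlinarith)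
      (sq_nonneg _) (Real.sin_sq_le_one θ)
  linarith

/-! ### The interval of single-bump parameters -/

/-- The set of parameters of the single-bump members of the `dn`-family. -/
def bumpSet (L : ℝ) : Set ℝ := {k | k ∈ Ioo 0 √2 ∧ IsSingleBump L (dnSolution k)}

lemma one_mem_bumpSet (L : ℝ) : 1 ∈ bumpSet L := ⟨one_mem_Ioo_sqrt_two, isSingleBump_one L⟩

lemma ordConnected_bumpSet (L : ℝ) : (bumpSet L).OrdConnected := by
  refine ⟨fun k hk l hl m hm => ?_⟩
  have hm0 : m ∈ Ioo 0 √2 := ⟨hk.1.1.trans_le hm.1, hm.2.trans_lt hl.1.2⟩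
  refine ⟨hm0, ?_⟩
  rcases lt_trichotomy m 1 with h | rfl | h
  · have hk1 := hm.1.trans_lt h
    rw [isSingleBump_iff_lt_halfPeriod hm0 h]
    exact ((isSingleBump_iff_lt_halfPeriod hk.1 hk1).1 hk.2).trans_le
      (halfPeriod_mono hk.1.1.le hm.1 h)
  · exact isSingleBump_one L
  · have hl1 := h.trans_le hm.2
    rw [isSingleBump_iff_lt_quarterPeriod hm0 h]
    exact ((isSingleBump_iff_lt_quarterPeriod hl.1 hl1).1 hl.2).trans_le
      (quarterPeriod_anti h hm.2)

/-- The complete integral is not available at modulus `1`. It is bounded below by the incomplete one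
at a fixed `φ < π / 2`, which is continuous at modulus `1` and equals `2 L > L` there. -/
lemma eventually_isSingleBump_one {L : ℝ} (hL : 0 < L) :
    ∀ᶠ k in nhds 1, IsSingleBump L (dnSolution k) := by
  set φ := Real.arctan (Real.sinh (2 * L)) with hφ
  have hF : ellipticF 1 φ = 2 * L := ellipticF_one_arctan_sinh _
  have hφ1 : φ < Real.pi / 2 := Real.arctan_lt_pi_div_two _
  have hφ0 : 0 ≤ φ := Real.arctan_nonneg.2 (Real.sinh_nonneg_iff.2 (by positivity))
  have hφD : φ ∈ amplitudeDomain 1 := by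
    rw [amplitudeDomain_one]; exact ⟨Real.neg_pi_div_two_lt_arctan _, hφ1⟩
  have hcF : ContinuousAt (fun κ => ellipticF κ φ) 1 :=
    continuousAt_ellipticF_modulus ⟨hφ0, hφ1.le⟩ (hφD φ right_mem_uIcc)
  have hinv : ContinuousAt (fun k : ℝ => 1 / k) 1 :=
    continuousAt_const.div continuousAt_id one_ne_zero
  have hcF' : ContinuousAt (fun k => ellipticF (1 / k) φ) 1 :=
    ContinuousAt.comp (f := fun k : ℝ => 1 / k) (g := fun κ => ellipticF κ φ)
      (by simpa using hcF) hinv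
  have hs : ContinuousAt (fun k : ℝ => √(2 - k ^ 2)) 1 := by fun_prop
  have hval : (√(2 - 1 ^ 2) : ℝ) = 1 := by norm_num
  have e1 : ∀ᶠ k in nhds 1, L < √(2 - k ^ 2) * ellipticF k φ :=
    ContinuousAt.eventually_lt continuousAt_const (hs.mul hcF)
      (by simp only [hval, hF]; linarith)
  have e2 : ∀ᶠ k in nhds 1, L < √(2 - k ^ 2) * (1 / k * ellipticF (1 / k) φ) :=
    ContinuousAt.eventually_lt continuousAt_const (hs.mul (hinv.mul hcF'))
      (by simp only [hval, div_one, hF]; linarith)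
  have hmono : ∀ κ, 0 ≤ κ → κ < 1 → ellipticF κ φ ≤ ellipticF κ (Real.pi / 2) := by
    intro κ h0 h1
    exact (strictMonoOn_ellipticF h0 h1.le).monotoneOn
      (by rw [amplitudeDomain_of_lt_one h0 h1]; trivial)
      (pi_div_two_mem_amplitudeDomain h0 h1) hφ1.le
  filter_upwards [e1, e2, Ioo_mem_nhds one_mem_Ioo_sqrt_two.1 one_mem_Ioo_sqrt_two.2]
    with k h1 h2 hk
  rcases lt_trichotomy k 1 with h | rfl | h
  · rw [isSingleBump_iff_lt_halfPeriod hk h]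
    exact h1.trans_le (mul_le_mul_of_nonneg_left (hmono k hk.1.le h) (Real.sqrt_nonneg _))
  · exact isSingleBump_one L
  · rw [isSingleBump_iff_lt_quarterPeriod hk h]
    have hk0 := hk.1
    exact h2.trans_le (mul_le_mul_of_nonneg_left (mul_le_mul_of_nonneg_left
      (hmono _ (by positivity) (by rwa [div_lt_one hk0])) (by positivity)) (Real.sqrt_nonneg _))

lemma isOpen_bumpSet {L : ℝ} (hL : 0 < L) : IsOpen (bumpSet L) := by
  refine isOpen_iff_mem_nhds.2 fun k ⟨hk, hb⟩ => ?_
  have hnhds := Ioo_mem_nhds hk.1 hk.2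
  rcases lt_trichotomy k 1 with h | rfl | h
  · rw [isSingleBump_iff_lt_halfPeriod hk h] at hb
    filter_upwards [hnhds, Iio_mem_nhds h, ContinuousAt.eventually_lt continuousAt_const
      (continuousAt_halfPeriod hk.1.le h) hb] with l hl hl1 hlt
    exact ⟨hl, (isSingleBump_iff_lt_halfPeriod hl hl1).2 hlt⟩
  · filter_upwards [hnhds, eventually_isSingleBump_one hL] with l hl hlt
    exact ⟨hl, hlt⟩
  · rw [isSingleBump_iff_lt_quarterPeriod hk h] at hb
    filter_upwards [hnhds, Ioi_mem_nhds h, ContinuousAt.eventually_lt continuousAt_const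
      (continuousAt_quarterPeriod h) hb] with l hl hl1 hlt
    exact ⟨hl, (isSingleBump_iff_lt_quarterPeriod hl hl1).2 hlt⟩

/-- The left end point of the interval of single-bump parameters. -/
noncomputable def bumpLeft (L : ℝ) : ℝ := sInf (bumpSet L)

/-- The right end point of the interval of single-bump parameters. -/
noncomputable def bumpRight (L : ℝ) : ℝ := sSup (bumpSet L)

lemma bddBelow_bumpSet (L : ℝ) : BddBelow (bumpSet L) := ⟨0, fun _ hk => hk.1.1.le⟩

lemma bddAbove_bumpSet (L : ℝ) : BddAbove (bumpSet L) := ⟨√2, fun _ hk => hk.1.2.le⟩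

lemma bumpSet_eq_Ioo {L : ℝ} (hL : 0 < L) : bumpSet L = Ioo (bumpLeft L) (bumpRight L) := by
  refine Subset.antisymm (fun k hk => ?_) ?_
  · obtain ⟨a, b, hab, hsub⟩ := mem_nhds_iff_exists_Ioo_subset.1 ((isOpen_bumpSet hL).mem_nhds hk)
    obtain ⟨l, hl⟩ := exists_between hab.1
    obtain ⟨r, hr⟩ := exists_between hab.2
    exact ⟨(csInf_le (bddBelow_bumpSet L) (hsub ⟨hl.1, hl.2.trans hab.2⟩)).trans_lt hl.2,
      hr.1.trans_le (le_csSup (bddAbove_bumpSet L) (hsub ⟨hab.1.trans hr.1, hr.2⟩))⟩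
  · exact IsConnected.Ioo_csInf_csSup_subset
      ⟨⟨1, one_mem_bumpSet L⟩, (ordConnected_bumpSet L).isPreconnected⟩
      (bddBelow_bumpSet L) (bddAbove_bumpSet L)

lemma one_mem_Ioo_bump {L : ℝ} (hL : 0 < L) : 1 ∈ Ioo (bumpLeft L) (bumpRight L) :=
  bumpSet_eq_Ioo hL ▸ one_mem_bumpSet L

lemma bumpLeft_nonneg (L : ℝ) : 0 ≤ bumpLeft L :=
  le_csInf ⟨1, one_mem_bumpSet L⟩ fun _ hk => hk.1.1.le

lemma bumpRight_le (L : ℝ) : bumpRight L ≤ √2 :=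
  csSup_le ⟨1, one_mem_bumpSet L⟩ fun _ hk => hk.1.2.le

lemma isSingleBump_iff_mem_Ioo {k L : ℝ} (hL : 0 < L) (hk : k ∈ Ioo 0 √2) :
    IsSingleBump L (dnSolution k) ↔ k ∈ Ioo (bumpLeft L) (bumpRight L) := by
  rw [← bumpSet_eq_Ioo hL]
  exact ⟨fun h => ⟨hk, h⟩, fun h => h.2⟩

/-- By continuity the half period at this end point is exactly `L`. -/
lemma dnSlope_bumpLeft {L : ℝ} (hL : 0 < L) (h0 : 0 < bumpLeft L) :
    dnSlope (bumpLeft L) L = 0 := by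
  have h1 := one_mem_Ioo_bump hL
  have hk : bumpLeft L ∈ Ioo 0 √2 := ⟨h0, h1.1.trans one_mem_Ioo_sqrt_two.2⟩
  have hle : halfPeriod (bumpLeft L) ≤ L := by
    by_contra! hc
    exact lt_irrefl _ ((isSingleBump_iff_mem_Ioo hL hk).1
      ((isSingleBump_iff_lt_halfPeriod hk h1.1).2 hc)).1
  have hge : L ≤ halfPeriod (bumpLeft L) := by
    refine ge_of_tendsto ((continuousAt_halfPeriod h0.le h1.1).tendsto.mono_left
      (nhdsWithin_le_nhds (s := Ioi (bumpLeft L)))) ?_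
    filter_upwards [Ioo_mem_nhdsGT h1.1] with k hk'
    have hk2 : k ∈ Ioo 0 √2 := ⟨h0.trans hk'.1, hk'.2.trans one_mem_Ioo_sqrt_two.2⟩
    exact ((isSingleBump_iff_lt_halfPeriod hk2 hk'.2).1
      ((isSingleBump_iff_mem_Ioo hL hk2).2 ⟨hk'.1, hk'.2.trans h1.2⟩)).le
  have := dnSlope_halfPeriod hk h1.1
  rwa [le_antisymm hle hge] at this

lemma dnSolution_bumpRight {L : ℝ} (hL : 0 < L) (h0 : bumpRight L < √2) :
    dnSolution (bumpRight L) L = 0 := by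
  have h1 := one_mem_Ioo_bump hL
  have hk : bumpRight L ∈ Ioo 0 √2 := ⟨one_pos.trans h1.2, h0⟩
  have hle : quarterPeriod (bumpRight L) ≤ L := by
    by_contra! hc
    exact lt_irrefl _ ((isSingleBump_iff_mem_Ioo hL hk).1
      ((isSingleBump_iff_lt_quarterPeriod hk h1.2).2 hc)).2
  have hge : L ≤ quarterPeriod (bumpRight L) := by
    refine ge_of_tendsto ((continuousAt_quarterPeriod h1.2).tendsto.mono_left
      (nhdsWithin_le_nhds (s := Iio (bumpRight L)))) ?_
    filter_upwards [Ioo_mem_nhdsLT h1.2] with k hk'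
    have hk2 : k ∈ Ioo 0 √2 := ⟨one_pos.trans hk'.1, hk'.2.trans h0⟩
    exact ((isSingleBump_iff_lt_quarterPeriod hk2 hk'.1).1
      ((isSingleBump_iff_mem_Ioo hL hk2).2 ⟨h1.1.trans hk'.1, hk'.2⟩)).le
  have := dnSolution_quarterPeriod hk h1.2
  rwa [le_antisymm hle hge] at this

/-! ### Comparison with the solitary wave -/

lemma sech_le (z : ℝ) : 1 / Real.cosh z ≤ 2 * Real.exp (-z) := by
  have h := Real.cosh_eq z
  have h1 := Real.exp_pos z
  have h2 := Real.exp_pos (-z)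
  have h3 : Real.exp z * Real.exp (-z) = 1 := by rw [← Real.exp_add]; simp
  rw [div_le_iff₀ (Real.cosh_pos z), h]
  nlinarith

lemma dnSolution_one_pos (z : ℝ) : 0 < dnSolution 1 z := by
  rw [dnSolution_one]; exact one_div_pos.2 (Real.cosh_pos z)

lemma dnSolution_one_le (z : ℝ) : dnSolution 1 z ≤ 2 * Real.exp (-z) :=
  dnSolution_one z ▸ sech_le z

lemma dnSolution_one_le_one (z : ℝ) : dnSolution 1 z ≤ 1 := by
  have := abs_dnSolution_le one_mem_Ioo_sqrt_two z
  rw [dnAmplitude_one] at this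
  exact (le_abs_self _).trans this

lemma abs_dnSlope_one_le {z : ℝ} (hz : 0 ≤ z) : |dnSlope 1 z| ≤ dnSolution 1 z := by
  have h1 := Real.cosh_pos z
  have h2 := Real.sinh_nonneg_iff.2 hz
  have h3 := (Real.sinh_lt_cosh z).le
  rw [dnSlope_one, dnSolution_one, abs_neg, abs_of_nonneg (by positivity),
    div_le_div_iff₀ (by positivity) h1]
  nlinarith

lemma mul_dnSolution_one_le_one {z : ℝ} (hz : 0 ≤ z) : z * dnSolution 1 z ≤ 1 := by
  rw [dnSolution_one, mul_one_div, div_le_one (Real.cosh_pos z)]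
  exact (Real.self_le_sinh_iff.2 hz).trans (Real.sinh_lt_cosh z).le

lemma abs_dnVar_one_le {z : ℝ} (hz : 0 ≤ z) : |dnVar 1 z| ≤ 4 * Real.exp z := by
  have h1 : |z * dnSlope 1 z| ≤ 1 := by
    rw [abs_mul, abs_of_nonneg hz]
    exact (mul_le_mul_of_nonneg_left (abs_dnSlope_one_le hz) hz).trans
      (mul_dnSolution_one_le_one hz)
  have h2 := dnSolution_one_pos z
  have h3 := dnSolution_one_le_one z
  have h4 : 1 ≤ Real.exp z := Real.one_le_exp hz
  have h5 : Real.exp (-z) ≤ 1 := Real.exp_le_one_iff.2 (by linarith)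
  have h6 := Real.exp_pos (-z)
  rw [dnVar, if_pos rfl, Real.cosh_eq]
  rw [abs_le] at h1 ⊢
  constructor <;> linarith [h1.1, h1.2]

lemma abs_dnAmplitude_sub_one_le {k : ℝ} (hk : |k - 1| ≤ 1 / 10) :
    k ∈ Ioo 0 √2 ∧ |dnAmplitude k - 1| ≤ 4 * |k - 1| ∧
      |k * dnAmplitude k ^ 3 - 1| ≤ 20 * |k - 1| := by
  have hk' := abs_le.1 hk
  have hmem : k ∈ Ioo 0 √2 := mem_Ioo_sqrt_two (by linarith) (by nlinarith)
  have ha := dnAmplitude_pos hmem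
  have hs := dnAmplitude_sq hmem
  set a := dnAmplitude k
  have hk2 : k ^ 2 ≤ 5 / 4 := by nlinarith
  have ha2 : a ^ 2 ≤ 4 / 3 := by nlinarith [pow_pos ha 2]
  have ha1 : a ≤ 6 / 5 := by nlinarith
  have h1 : |a - 1| ≤ 4 * |k - 1| := by
    have e : (a - 1) * (a + 1) = a ^ 2 * (k + 1) * (k - 1) := by linear_combination hs
    have e2 : |a - 1| * (a + 1) = a ^ 2 * (k + 1) * |k - 1| := by
      have := congrArg abs e
      rwa [abs_mul, abs_mul, abs_of_pos (by linarith : 0 < a + 1),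
        abs_of_pos (mul_pos (pow_pos ha 2) (by linarith : 0 < k + 1))] at this
    have h3 : a ^ 2 * (k + 1) ≤ 4 := by nlinarith
    nlinarith [abs_nonneg (a - 1), abs_nonneg (k - 1)]
  refine ⟨hmem, h1, ?_⟩
  rw [show k * a ^ 3 - 1 = a ^ 3 * (k - 1) + (a ^ 2 + a + 1) * (a - 1) by ring]
  refine (abs_add_le _ _).trans ?_
  rw [abs_mul, abs_mul, abs_of_pos (by positivity : 0 < a ^ 3),
    abs_of_pos (by positivity : 0 < a ^ 2 + a + 1)]
  have h3 : a ^ 3 ≤ 2 := by nlinarith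
  have h4 : (a ^ 2 + a + 1) * |a - 1| ≤ (4 / 3 + 6 / 5 + 1) * (4 * |k - 1|) :=
    mul_le_mul (by linarith) h1 (abs_nonneg _) (by norm_num)
  nlinarith [abs_nonneg (k - 1)]

/-- The exponential weight of the comparison functions on `[0, L]`. -/
noncomputable def weight (m z : ℝ) : ℝ := Real.exp (z + 12 * (1 - Real.exp (-2 * z)) + m * z)

lemma hasDerivAt_weight (m z : ℝ) :
    HasDerivAt (weight m) (weight m z * (1 + 24 * Real.exp (-2 * z) + m)) z := by
  have hz := hasDerivAt_id z
  have h1 : HasDerivAt (fun z => Real.exp (-2 * z)) (Real.exp (-2 * z) * (-2 * 1)) z :=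
    (hz.const_mul (-2)).exp
  refine ((hz.add ((h1.const_sub 1).const_mul 12)).add (hz.const_mul m)).exp.congr_deriv ?_
  simp only [weight, id, Pi.add_apply]
  ring

lemma weight_zero (m : ℝ) : weight m 0 = 1 := by simp [weight]

lemma weight_pos (m z : ℝ) : 0 < weight m z := Real.exp_pos _

lemma exp_le_weight {m z : ℝ} (hm : 0 ≤ m) (hz : 0 ≤ z) : Real.exp z ≤ weight m z := by
  have : Real.exp (-2 * z) ≤ 1 := Real.exp_le_one_iff.2 (by linarith)
  exact Real.exp_le_exp.2 (by nlinarith)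

/-- The term `24 e^(-2z)` in the logarithmic derivative dominates `6 sech²` and integrates to at
most `12`; the term `m` contributes at most `1`. Hence the factor `e^13`. -/
lemma weight_le {m z L : ℝ} (hm : 0 ≤ m) (hz : z ∈ Icc 0 L) (hmL : m * L ≤ 1) :
    weight m z ≤ Real.exp 13 * Real.exp z := by
  rw [← Real.exp_add]
  refine Real.exp_le_exp.2 ?_
  have := Real.exp_pos (-2 * z)
  have : m * z ≤ m * L := mul_le_mul_of_nonneg_left hz.2 hm
  linarith

lemma exp_neg_mul_exp (z : ℝ) : Real.exp (-z) * Real.exp z = 1 := by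
  rw [← Real.exp_add]; simp

lemma exp_neg_two_mul (z : ℝ) : Real.exp (-2 * z) = Real.exp (-z) ^ 2 := by
  rw [← Real.exp_nat_mul]; ring_nf

lemma exp_neg_mul_exp_le_one {z L : ℝ} (hz : z ∈ Icc 0 L) :
    Real.exp (-L) * Real.exp z ≤ 1 := by
  rw [← Real.exp_add]; exact Real.exp_le_one_iff.2 (by linarith [hz.2])

/-- A bootstrap: below the barrier the difference is at most `M e^(-2L) e^z`, so the nonlinear terms
change the linear coefficient only by a multiple of `e^(-2L)`, which `m` absorbs. -/
lemma abs_dnSolution_sub_one_le {k L M : ℝ} (hM : M = 64 * Real.exp 13)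
    (hk : |k - 1| ≤ 16 * Real.exp (-L) ^ 2) (hk' : |k - 1| ≤ 1 / 10)
    (hL : (12 * M + 2 * M ^ 2 + 1) * Real.exp (-L) ^ 2 * L ≤ 1) :
    ∀ z ∈ Icc 0 L, |dnSolution k z - dnSolution 1 z| ≤ M * Real.exp (-L) ^ 2 * Real.exp z := by
  obtain ⟨hmem, ha, -⟩ := abs_dnAmplitude_sub_one_le hk'
  have hM0 : 0 < M := by rw [hM]; positivity
  set x := Real.exp (-L) with hx
  have hx0 : 0 < x := Real.exp_pos _
  -- `12 M` bounds the cross term `6 s (u - s)`, `2 M²` the term `2 (u - s)²`, and the last `1`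
  -- gives strictness.
  set m := (12 * M + 2 * M ^ 2 + 1) * x ^ 2 with hm
  have hm0 : 0 ≤ m := by positivity
  have hle : ∀ z ∈ Icc 0 L, 64 * x ^ 2 * weight m z ≤ M * x ^ 2 * Real.exp z := by
    intro z hz
    have := mul_le_mul_of_nonneg_left (weight_le hm0 hz hL) (by positivity : 0 ≤ 64 * x ^ 2)
    rw [hM]
    linarith
  have h0 : |dnAmplitude k - 1| ≤ 64 * x ^ 2 := by linarith
  have main := abs_le_barrier (L := L)
    (fun z => (hasDerivAt_dnSolution hmem z).sub (hasDerivAt_dnSolution one_mem_Ioo_sqrt_two z))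
    (fun z => (hasDerivAt_dnSlope hmem z).sub (hasDerivAt_dnSlope one_mem_Ioo_sqrt_two z))
    (fun z => (hasDerivAt_weight m z).const_mul (64 * x ^ 2)) ?_ ?_ ?_ ?_
  · exact fun z hz => (main z hz).1.trans (hle z hz)
  · simpa [weight_zero, dnSolution_zero hmem, dnSolution_zero one_mem_Ioo_sqrt_two,
      dnAmplitude_one] using h0
  · simp [weight_zero, dnSlope_zero hmem, dnSlope_zero one_mem_Ioo_sqrt_two]
    positivity
  · intro z _
    have h1 := Real.exp_pos (-2 * z)
    have h2 : 0 < 64 * x ^ 2 * weight m z := mul_pos (by positivity) (weight_pos _ _)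
    have h3 : 0 < m := by positivity
    nlinarith
  · intro z hz hB
    have hz' := Ico_subset_Icc_self hz
    have h2 : 0 < 64 * x ^ 2 * weight m z := mul_pos (by positivity) (weight_pos _ _)
    have hd := hB.trans (hle z hz')
    have hs0 := dnSolution_one_pos z
    have hs := dnSolution_one_le z
    have hee := exp_neg_mul_exp z
    have hxz := exp_neg_mul_exp_le_one hz'
    rw [exp_neg_two_mul z]
    simp only [Pi.sub_apply] at hB hd ⊢
    set u := dnSolution k z
    set s := dnSolution 1 z
    set B := 64 * x ^ 2 * weight m z with hBdef
    set X := Real.exp z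
    set Y := Real.exp (-z)
    have hX : 0 < X := Real.exp_pos _
    have hY : 0 < Y := Real.exp_pos _
    rw [show u - 2 * u ^ 3 - (s - 2 * s ^ 3)
      = (1 - 6 * s ^ 2 - 6 * s * (u - s) - 2 * (u - s) ^ 2) * (u - s) by ring, abs_mul]
    have hs2 : s ^ 2 ≤ 4 * Y ^ 2 := by nlinarith
    have hsd : s * |u - s| ≤ 2 * M * x ^ 2 := by
      calc s * |u - s| ≤ (2 * Y) * (M * x ^ 2 * X) :=
            mul_le_mul hs hd (abs_nonneg _) (by positivity)
        _ = 2 * M * x ^ 2 * (Y * X) := by ring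
        _ = 2 * M * x ^ 2 := by rw [hee, mul_one]
    have hd2 : |u - s| ^ 2 ≤ M ^ 2 * x ^ 2 := by
      calc |u - s| ^ 2 ≤ (M * x ^ 2 * X) ^ 2 := pow_le_pow_left₀ (abs_nonneg _) hd 2
        _ = M ^ 2 * x ^ 2 * (x * X) ^ 2 := by ring
        _ ≤ M ^ 2 * x ^ 2 * 1 := mul_le_mul_of_nonneg_left
            (pow_le_one₀ (by positivity) hxz) (by positivity)
        _ = M ^ 2 * x ^ 2 := mul_one _
    have hcoef : |1 - 6 * s ^ 2 - 6 * s * (u - s) - 2 * (u - s) ^ 2| <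
        1 + 24 * Y ^ 2 + m := by
      have h3 : |s * (u - s)| ≤ 2 * M * x ^ 2 := by rwa [abs_mul, abs_of_pos hs0]
      rw [sq_abs] at hd2
      have h4 := abs_le.1 h3
      have h5 : 0 < x ^ 2 := by positivity
      rw [abs_lt]
      constructor <;> nlinarith [sq_nonneg s, sq_nonneg (u - s)]
    calc |1 - 6 * s ^ 2 - 6 * s * (u - s) - 2 * (u - s) ^ 2| * |u - s|
        ≤ |1 - 6 * s ^ 2 - 6 * s * (u - s) - 2 * (u - s) ^ 2| * B :=
          mul_le_mul_of_nonneg_left hB (abs_nonneg _)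
      _ < (1 + 24 * Y ^ 2 + m) * B := mul_lt_mul_of_pos_right hcoef h2
      _ = 64 * x ^ 2 * (weight m z * (1 + 24 * Y ^ 2 + m)) := by rw [hBdef]; ring

/-- The source `6 w (u² - s²)` is at most `24 N e^(-2L)` times the weight, so it grows at the
homogeneous rate. This resonance is met by a barrier with a linear factor in `z`, the origin of the
`L` in the error terms. -/
lemma abs_dnVar_sub_one_le {k L M N : ℝ} (hM : M = 64 * Real.exp 13) (hN : N = 4 * M + M ^ 2)
    (hk : |k - 1| ≤ 16 * Real.exp (-L) ^ 2) (hk' : |k - 1| ≤ 1 / 10)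
    (hL1 : 1 ≤ L) (hL : (12 * M + 2 * M ^ 2 + 1) * Real.exp (-L) ^ 2 * L ≤ 1)
    (hL' : 6 * N * Real.exp (-L) ^ 2 * L ≤ 1) :
    |dnVar k L - dnVar 1 L| ≤ Real.exp 13 * (24 * N + 321) * L * Real.exp (-L) ∧
    |dnVarSlope k L - dnVarSlope 1 L| ≤ Real.exp 13 * (24 * N + 321) * L * Real.exp (-L) := by
  obtain ⟨hmem, -, hka⟩ := abs_dnAmplitude_sub_one_le hk'
  have hdiff := abs_dnSolution_sub_one_le hM hk hk' hL
  have hM0 : 0 < M := by rw [hM]; positivity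
  have hN0 : 0 < N := by rw [hN]; positivity
  have h1m := one_mem_Ioo_sqrt_two
  set x := Real.exp (-L) with hx
  have hx0 : 0 < x := Real.exp_pos _
  set m := 6 * N * x ^ 2 with hm
  have hm0 : 0 ≤ m := by positivity
  have h0 : |k * dnAmplitude k ^ 3 - 1| ≤ 320 * x ^ 2 := by linarith
  -- `320 = 20 · 16` covers the initial discrepancy, `24 N` the source, and the extra `1` gives
  -- strictness.
  have hB : ∀ z, HasDerivAt (fun z => x ^ 2 * (weight m z * (320 + (24 * N + 1) * z)))
      (x ^ 2 * (weight m z * (1 + 24 * Real.exp (-2 * z) + m) * (320 + (24 * N + 1) * z)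
        + weight m z * ((24 * N + 1) * 1))) z := fun z =>
    ((hasDerivAt_weight m z).mul (((hasDerivAt_id z).const_mul (24 * N + 1)).const_add
      320)).const_mul (x ^ 2)
  have main := abs_le_barrier (L := L)
    (fun z => (hasDerivAt_dnVar hmem z).sub (hasDerivAt_dnVar h1m z))
    (fun z => (hasDerivAt_dnVarSlope hmem z).sub (hasDerivAt_dnVarSlope h1m z))
    hB ?_ ?_ ?_ ?_
  · have hle : x ^ 2 * (weight m L * (320 + (24 * N + 1) * L)) ≤
        Real.exp 13 * (24 * N + 321) * L * x := by
      calc x ^ 2 * (weight m L * (320 + (24 * N + 1) * L))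
          ≤ x ^ 2 * ((Real.exp 13 * Real.exp L) * ((24 * N + 321) * L)) := by
            refine mul_le_mul_of_nonneg_left (mul_le_mul
              (weight_le hm0 ⟨by linarith, le_rfl⟩ hL') ?_ ?_ (by positivity)) (by positivity)
            · linarith
            · have : 0 < L := by linarith
              positivity
        _ = Real.exp 13 * (24 * N + 321) * L * x * (x * Real.exp L) := by ring
        _ = _ := by rw [hx, exp_neg_mul_exp, mul_one]
    have := main L ⟨by linarith, le_rfl⟩
    exact ⟨this.1.trans hle, this.2.trans hle⟩
  · simp only [Pi.sub_apply, dnVar_zero hmem, dnVar_zero h1m, dnAmplitude_one, weight_zero]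
    norm_num
    linarith
  · simp only [dnVarSlope_zero hmem, dnVarSlope_zero h1m, weight_zero]
    norm_num
    positivity
  · intro z hz
    have h1 := Real.exp_pos (-2 * z)
    have hw := weight_pos m z
    have h2 : 0 < x ^ 2 * (weight m z * (320 + (24 * N + 1) * z)) := by
      have := hz.1
      positivity
    have h3 : 0 < x ^ 2 * (weight m z * (24 * N + 1)) := by positivity
    have h4 : 0 ≤ (x ^ 2 * (weight m z * (320 + (24 * N + 1) * z))) *
        (24 * Real.exp (-2 * z) + m) := mul_nonneg h2.le (by positivity)
    linarith
  · intro z hz hBz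
    have hz' := Ico_subset_Icc_self hz
    have hd := hdiff z hz'
    have hs0 := dnSolution_one_pos z
    have hs := dnSolution_one_le z
    have hee := exp_neg_mul_exp z
    have hxz := exp_neg_mul_exp_le_one hz'
    have hw1 := abs_dnVar_one_le hz.1
    have hweight := exp_le_weight hm0 hz.1
    have hwpos := weight_pos m z
    rw [exp_neg_two_mul z]
    simp only [Pi.sub_apply] at hBz ⊢
    set u := dnSolution k z
    set s := dnSolution 1 z
    set v := dnVar k z
    set w := dnVar 1 z
    set W := weight m z
    set X := Real.exp z
    set Y := Real.exp (-z)
    have hX : 0 < X := Real.exp_pos _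
    have hY : 0 < Y := Real.exp_pos _
    have hsq : |u ^ 2 - s ^ 2| ≤ N * x ^ 2 := by
      rw [show u ^ 2 - s ^ 2 = (u - s) * (2 * s + (u - s)) by ring, abs_mul]
      have h3 : |2 * s + (u - s)| ≤ 4 * Y + M * x ^ 2 * X := by
        refine (abs_add_le _ _).trans ?_
        rw [abs_of_pos (by linarith : 0 < 2 * s)]
        linarith
      calc |u - s| * |2 * s + (u - s)| ≤ (M * x ^ 2 * X) * (4 * Y + M * x ^ 2 * X) :=
            mul_le_mul hd h3 (abs_nonneg _) (by positivity)
        _ = 4 * M * x ^ 2 * (Y * X) + M ^ 2 * x ^ 2 * (x * X) ^ 2 := by ring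
        _ ≤ 4 * M * x ^ 2 * 1 + M ^ 2 * x ^ 2 * 1 := by
            rw [hee]
            exact add_le_add le_rfl (mul_le_mul_of_nonneg_left
              (pow_le_one₀ (by positivity) hxz) (by positivity))
        _ = N * x ^ 2 := by rw [hN]; ring
    have hs2 : s ^ 2 ≤ 4 * Y ^ 2 := by nlinarith
    rw [show v - 6 * u ^ 2 * v - (w - 6 * s ^ 2 * w)
      = (1 - 6 * s ^ 2 - 6 * (u ^ 2 - s ^ 2)) * (v - w) - 6 * w * (u ^ 2 - s ^ 2) by ring]
    have hcoef : |1 - 6 * s ^ 2 - 6 * (u ^ 2 - s ^ 2)| ≤ 1 + 24 * Y ^ 2 + m := by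
      have h4 := abs_le.1 hsq
      rw [abs_le]
      constructor <;> nlinarith [sq_nonneg s]
    have hsrc : |6 * w * (u ^ 2 - s ^ 2)| ≤ x ^ 2 * (24 * N * W) := by
      rw [abs_mul, abs_mul, abs_of_pos (by norm_num : (0 : ℝ) < 6)]
      calc 6 * |w| * |u ^ 2 - s ^ 2| ≤ 6 * (4 * W) * (N * x ^ 2) :=
            mul_le_mul (by linarith) hsq (abs_nonneg _) (by positivity)
        _ = _ := by ring
    have h5 : |(1 - 6 * s ^ 2 - 6 * (u ^ 2 - s ^ 2)) * (v - w)| ≤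
        (1 + 24 * Y ^ 2 + m) * (x ^ 2 * (W * (320 + (24 * N + 1) * z))) := by
      rw [abs_mul]
      exact mul_le_mul hcoef hBz (abs_nonneg _) (by positivity)
    have h6 : 0 < x ^ 2 * W := by positivity
    calc _ ≤ _ := (abs_sub _ _).trans (add_le_add h5 hsrc)
      _ < _ := by linarith

/-- The term `-cosh / 2`, or `-sinh / 2` for the slope, supplies `-e^L / 4`; the rest is `O(L
e^(-L))`. -/
lemma abs_dnVar_one_add_le {L : ℝ} (hL : 1 ≤ L) :
    |dnVar 1 L + 1 / 4 * Real.exp L| ≤ 16 * L * Real.exp (-L) ∧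
    |dnVarSlope 1 L + 1 / 4 * Real.exp L| ≤ 16 * L * Real.exp (-L) := by
  have h0 : 0 ≤ L := by linarith
  have hs0 := dnSolution_one_pos L
  have hs := dnSolution_one_le L
  have hs1 := dnSolution_one_le_one L
  have hd := abs_le.1 ((abs_dnSlope_one_le h0).trans hs)
  rw [dnVar, dnVarSlope, if_pos rfl, if_pos rfl, Real.cosh_eq, Real.sinh_eq]
  set x := Real.exp (-L)
  have hx : 0 < x := Real.exp_pos _
  set s := dnSolution 1 L
  set d := dnSlope 1 L
  have h1 : |L * d| ≤ L * (2 * x) := by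
    rw [abs_mul, abs_of_nonneg h0]
    exact mul_le_mul_of_nonneg_left (abs_le.2 hd) h0
  have hcube : |s - 2 * s ^ 3| ≤ 3 * s := by
    have : s ^ 3 ≤ s := by nlinarith [mul_pos hs0 hs0]
    have := pow_pos hs0 3
    rw [abs_le]; constructor <;> linarith
  have h2 : |L * (s - 2 * s ^ 3)| ≤ L * (6 * x) := by
    rw [abs_mul, abs_of_nonneg h0]
    exact mul_le_mul_of_nonneg_left (hcube.trans (by linarith)) h0
  have h1' := abs_le.1 h1
  have h2' := abs_le.1 h2
  have hxL : x ≤ L * x := by nlinarith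
  constructor <;> rw [abs_le] <;> constructor <;> linarith [h1'.1, h1'.2, h2'.1, h2'.2, hd.1, hd.2]

lemma tendsto_mul_exp_neg_sq_mul (c : ℝ) :
    Tendsto (fun L : ℝ => c * Real.exp (-L) ^ 2 * L) atTop (nhds 0) := by
  have h1 := Real.tendsto_pow_mul_exp_neg_atTop_nhds_zero 1
  have h2 := Real.tendsto_exp_neg_atTop_nhds_zero
  have := (h1.mul h2).const_mul c
  simp only [mul_zero] at this
  refine this.congr fun L => ?_
  ring

lemma eventually_abs_dnVar_add_le : ∃ C : ℝ, 0 < C ∧ ∀ᶠ L : ℝ in atTop, ∀ k : ℝ,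
    |k - 1| ≤ 16 * Real.exp (-L) ^ 2 → k ∈ Ioo 0 √2 ∧
      |dnVar k L + 1 / 4 * Real.exp L| ≤ C * L * Real.exp (-L) ∧
      |dnVarSlope k L + 1 / 4 * Real.exp L| ≤ C * L * Real.exp (-L) := by
  obtain ⟨M, hM⟩ : ∃ M, M = 64 * Real.exp 13 := ⟨_, rfl⟩
  obtain ⟨N, hN⟩ : ∃ N, N = 4 * M + M ^ 2 := ⟨_, rfl⟩
  have hM0 : 0 < M := by rw [hM]; positivity
  have hN0 : 0 < N := by rw [hN]; positivity
  refine ⟨Real.exp 13 * (24 * N + 321) + 16, by positivity, ?_⟩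
  filter_upwards [eventually_ge_atTop 1,
    (tendsto_mul_exp_neg_sq_mul (12 * M + 2 * M ^ 2 + 1)).eventually (ge_mem_nhds one_pos),
    (tendsto_mul_exp_neg_sq_mul (6 * N)).eventually (ge_mem_nhds one_pos),
    (tendsto_mul_exp_neg_sq_mul 160).eventually (ge_mem_nhds one_pos)] with L hL1 h1 h2 h3 k hk
  have hk' : |k - 1| ≤ 1 / 10 := by nlinarith [pow_pos (Real.exp_pos (-L)) 2]
  -- The previous bound uses `160 e^(-2L) L ≤ 1` with `L ≥ 1`, which gives `16 e^(-2L) ≤ 1 / 10`.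
  obtain ⟨ha, hb⟩ := abs_dnVar_sub_one_le hM hN hk hk' hL1 h1 h2
  obtain ⟨hc, hd⟩ := abs_dnVar_one_add_le hL1
  refine ⟨(abs_dnAmplitude_sub_one_le hk').1, ?_, ?_⟩
  · rw [show dnVar k L + 1 / 4 * Real.exp L
      = (dnVar k L - dnVar 1 L) + (dnVar 1 L + 1 / 4 * Real.exp L) by ring]
    exact (abs_add_le _ _).trans (by linarith)
  · rw [show dnVarSlope k L + 1 / 4 * Real.exp L
      = (dnVarSlope k L - dnVarSlope 1 L) + (dnVarSlope 1 L + 1 / 4 * Real.exp L) by ring]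
    exact (abs_add_le _ _).trans (by linarith)

/-! ### Expansions of the boundary values -/

lemma abs_dnSolution_one_sub_le (L : ℝ) :
    |dnSolution 1 L - 2 * Real.exp (-L)| ≤ 2 * Real.exp (-L) ^ 3 := by
  have hc := Real.cosh_eq L
  have hcp := Real.cosh_pos L
  have hee := exp_neg_mul_exp L
  have hs := sech_le L
  rw [dnSolution_one]
  set x := Real.exp (-L)
  have hx : 0 < x := Real.exp_pos _
  have hs0 : 0 < 1 / Real.cosh L := one_div_pos.2 hcp
  have e : 1 / Real.cosh L - 2 * x = -(x ^ 2 * (1 / Real.cosh L)) := by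
    field_simp
    rw [hc]
    linear_combination -hee
  rw [e, abs_neg, abs_of_pos (by positivity)]
  have := mul_le_mul_of_nonneg_left hs (sq_nonneg x)
  linarith

lemma abs_dnSlope_one_add_le (L : ℝ) :
    |dnSlope 1 L + 2 * Real.exp (-L)| ≤ 6 * Real.exp (-L) ^ 3 := by
  have h1 := abs_le.1 (abs_dnSolution_one_sub_le L)
  have hcp := Real.cosh_pos L
  have hs := sech_le L
  have hs0 : 0 < 1 / Real.cosh L := one_div_pos.2 hcp
  have hcs := Real.cosh_sub_sinh L
  have e : dnSlope 1 L = -(dnSolution 1 L) + Real.exp (-L) * (1 / Real.cosh L) ^ 2 := by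
    rw [dnSlope_one, dnSolution_one, ← hcs]
    field_simp
    ring
  rw [e]
  set x := Real.exp (-L)
  have hx : 0 < x := Real.exp_pos _
  have h2 : x * (1 / Real.cosh L) ^ 2 ≤ x * (2 * x) ^ 2 :=
    mul_le_mul_of_nonneg_left (pow_le_pow_left₀ hs0.le hs 2) hx.le
  have h3 : 0 < x * (1 / Real.cosh L) ^ 2 := by positivity
  rw [abs_le]
  constructor <;> nlinarith [h1.1, h1.2, pow_pos hx 3]

/-- Mean value inequality for `f k + c k`. -/
lemma abs_sub_le_of_abs_deriv_add_le {f f' : ℝ → ℝ} {r c D : ℝ}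
    (hf : ∀ k, |k - 1| ≤ r → HasDerivAt f (f' k) k) (hb : ∀ k, |k - 1| ≤ r → |f' k + c| ≤ D)
    {k : ℝ} (hk : |k - 1| ≤ r) : |f k - f 1 + c * (k - 1)| ≤ D * |k - 1| := by
  have hr : 0 ≤ r := (abs_nonneg _).trans hk
  have := (convex_closedBall (1 : ℝ) r).norm_image_sub_le_of_norm_hasDerivWithin_le
    (f := fun k => f k + c * k) (f' := fun k => f' k + c * 1) (C := D) (x := 1) (y := k)
    (fun l hl => ((hf l (by simpa [Real.dist_eq] using hl)).add
      ((hasDerivAt_id l).const_mul c)).hasDerivWithinAt)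
    (fun l hl => by simpa using hb l (by simpa [Real.dist_eq] using hl))
    (by simpa using hr) (by simpa [Real.dist_eq] using hk)
  rw [Real.norm_eq_abs, Real.norm_eq_abs] at this
  rwa [show f k + c * k - (f 1 + c * 1) = f k - f 1 + c * (k - 1) by ring] at this

lemma eventually_boundary_expansion : ∃ C : ℝ, 0 < C ∧ ∀ᶠ L : ℝ in atTop, ∀ k : ℝ,
    |k - 1| ≤ 16 * Real.exp (-L) ^ 2 → k ∈ Ioo 0 √2 ∧
      |dnSolution k L - (2 * Real.exp (-L) - 1 / 4 * (k - 1) * Real.exp L)|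
        ≤ C * L * Real.exp (-L) ^ 3 ∧
      |dnSlope k L - (-2 * Real.exp (-L) - 1 / 4 * (k - 1) * Real.exp L)|
        ≤ C * L * Real.exp (-L) ^ 3 ∧
      |dnVar k L + 1 / 4 * Real.exp L| ≤ C * L * Real.exp (-L) ∧
      |dnVarSlope k L + 1 / 4 * Real.exp L| ≤ C * L * Real.exp (-L) := by
  obtain ⟨C, hC, hev⟩ := eventually_abs_dnVar_add_le
  refine ⟨16 * C + 6, by positivity, ?_⟩
  filter_upwards [hev, eventually_ge_atTop 1] with L h hL k hk
  obtain ⟨hmem, h1, h2⟩ := h k hk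
  have hL0 : 0 ≤ L := by linarith
  have hp := abs_sub_le_of_abs_deriv_add_le
    (fun l hl => (hasDerivAt_dnSolution_param (h l hl).1 hL0).1) (fun l hl => (h l hl).2.1) hk
  have hq := abs_sub_le_of_abs_deriv_add_le
    (fun l hl => (hasDerivAt_dnSolution_param (h l hl).1 hL0).2) (fun l hl => (h l hl).2.2) hk
  have hp1 := abs_dnSolution_one_sub_le L
  have hq1 := abs_dnSlope_one_add_le L
  set x := Real.exp (-L)
  have hx : 0 < x := Real.exp_pos _
  have hbound : C * L * x * |k - 1| ≤ 16 * C * L * x ^ 3 := by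
    have := mul_le_mul_of_nonneg_left hk (by positivity : 0 ≤ C * L * x)
    linarith
  have hx3 : x ^ 3 ≤ L * x ^ 3 := le_mul_of_one_le_left (by positivity) hL
  have hx0 : 0 < x ^ 3 := by positivity
  have hxL : 0 ≤ L * x := by positivity
  have hCL : 0 ≤ C * (L * x) := by positivity
  refine ⟨hmem, ?_, ?_, h1.trans (by linarith), h2.trans (by linarith)⟩
  · rw [show dnSolution k L - (2 * x - 1 / 4 * (k - 1) * Real.exp L)
      = (dnSolution k L - dnSolution 1 L + 1 / 4 * Real.exp L * (k - 1))
        + (dnSolution 1 L - 2 * x) by ring]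
    exact (abs_add_le _ _).trans (by linarith)
  · rw [show dnSlope k L - (-2 * x - 1 / 4 * (k - 1) * Real.exp L)
      = (dnSlope k L - dnSlope 1 L + 1 / 4 * Real.exp L * (k - 1))
        + (dnSlope 1 L + 2 * x) by ring]
    exact (abs_add_le _ _).trans (by linarith)

/-- The end points of the single-bump interval are the zeros of the boundary value and of the
boundary slope, so that their expansions follow from those of the latter. -/
lemma eventually_bump_expansion : ∃ C : ℝ, 0 < C ∧ ∀ᶠ L : ℝ in atTop,
    |bumpLeft L - (1 - 8 * Real.exp (-L) ^ 2)| ≤ C * L * Real.exp (-L) ^ 4 ∧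
    |bumpRight L - (1 + 8 * Real.exp (-L) ^ 2)| ≤ C * L * Real.exp (-L) ^ 4 ∧
    ∀ k ∈ Ioo (bumpLeft L) (bumpRight L), |k - 1| ≤ 16 * Real.exp (-L) ^ 2 := by
  obtain ⟨C, hC, hev⟩ := eventually_boundary_expansion
  refine ⟨4 * C, by positivity, ?_⟩
  filter_upwards [hev, eventually_ge_atTop 1,
    (tendsto_mul_exp_neg_sq_mul C).eventually (ge_mem_nhds one_pos)] with L h hL1 hCL
  have hL : 0 < L := by linarith
  have hone := one_mem_Ioo_bump hL
  have hee := exp_neg_mul_exp L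
  set x := Real.exp (-L)
  set X := Real.exp L
  have hx : 0 < x := Real.exp_pos _
  have hCx : C * L * x ^ 3 ≤ x := by nlinarith
  have hxX : x ^ 2 * X = x := by linear_combination x * hee
  -- The window is twice the expected offset `8 x²`. At its right edge the leading part of the
  -- boundary value is `2 x - 4 x = -2 x`, and the error is at most `x`, so positivity fails. At the
  -- left edge the slope is positive in the same way.
  have hright : bumpRight L ≤ 1 + 16 * x ^ 2 := by
    by_contra! hc
    have hk : |1 + 16 * x ^ 2 - 1| ≤ 16 * x ^ 2 := by
      rw [add_sub_cancel_left, abs_of_pos (by positivity)]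
    obtain ⟨hmem, hp, -⟩ := h _ hk
    have hb := (isSingleBump_iff_mem_Ioo hL hmem).2
      ⟨hone.1.trans (lt_add_of_pos_right 1 (by positivity)), hc⟩
    have := (hb L ⟨hL, le_rfl⟩).1
    have h2 := (abs_le.1 hp).2
    linarith
  have hleft : 1 - 16 * x ^ 2 ≤ bumpLeft L := by
    by_contra! hc
    have hk : |1 - 16 * x ^ 2 - 1| ≤ 16 * x ^ 2 := by
      rw [sub_sub_cancel_left, abs_neg, abs_of_pos (by positivity)]
    obtain ⟨hmem, -, hq, -⟩ := h _ hk
    have hb := (isSingleBump_iff_mem_Ioo hL hmem).2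
      ⟨hc, (sub_lt_self 1 (by positivity)).trans hone.2⟩
    have := (hb L ⟨hL, le_rfl⟩).2
    rw [deriv_dnSolution hmem] at this
    have h2 := (abs_le.1 hq).1
    linarith
  have hx2 : 0 < x ^ 2 := by positivity
  refine ⟨?_, ?_, fun k hk => abs_le.2 ⟨by linarith [hk.1], by linarith [hk.2]⟩⟩
  · obtain ⟨hmem, -, hq, -⟩ := h (bumpLeft L) (abs_le.2 ⟨by linarith, by linarith [hone.1]⟩)
    rw [dnSlope_bumpLeft hL hmem.1] at hq
    -- Multiplying by `4 x = 4 / X` solves the leading part of the vanishing slope for `bumpLeft L -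
    -- 1`.
    have e : bumpLeft L - (1 - 8 * x ^ 2)
        = 4 * x * (0 - (-2 * x - 1 / 4 * (bumpLeft L - 1) * X)) := by
      linear_combination -(bumpLeft L - 1) * hee
    rw [e, abs_mul, abs_of_pos (by positivity : 0 < 4 * x)]
    have := mul_le_mul_of_nonneg_left hq (by positivity : 0 ≤ 4 * x)
    linarith
  · obtain ⟨hmem, hp, -⟩ := h (bumpRight L) (abs_le.2 ⟨by linarith [hone.2], by linarith⟩)
    rw [dnSolution_bumpRight hL hmem.2] at hp
    have e : bumpRight L - (1 + 8 * x ^ 2)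
        = 4 * x * (0 - (2 * x - 1 / 4 * (bumpRight L - 1) * X)) := by
      linear_combination -(bumpRight L - 1) * hee
    rw [e, abs_mul, abs_of_pos (by positivity : 0 < 4 * x)]
    have := mul_le_mul_of_nonneg_left hp (by positivity : 0 ≤ 4 * x)
    linarith

/-! ### Assembly of the theorem. -/

theorem lemma2p5 :
    -- the `dn`-family parameterizes the part of the DtN manifold with `Ψ(0) > 1 / √2`
    (∀ L : ℝ, 0 < L →
      (∀ k ∈ Ioo (0 : ℝ) √2,
        IsNeumannSolution L (dnSolution k) (deriv (dnSolution k)) ∧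
        dnSolution k 0 = 1 / √(2 - k ^ 2)) ∧
      dtnBranch L = (fun k => (boundaryValue L k, boundarySlope L k)) '' Ioo (0 : ℝ) √2) ∧
    -- the boundary values are `C¹` functions of `k`
    (∀ L : ℝ, 0 < L →
      ContDiffOn ℝ 1 (boundaryValue L) (Ioo 0 √2) ∧
      ContDiffOn ℝ 1 (boundarySlope L) (Ioo 0 √2)) ∧
    ∃ kminus kplus : ℝ → ℝ,
      -- the interval of single-bump parameters
      (∀ L : ℝ, 0 < L →
        0 ≤ kminus L ∧ kminus L < kplus L ∧ kplus L ≤ √2 ∧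
        ∀ k ∈ Ioo (0 : ℝ) √2,
          IsSingleBump L (dnSolution k) ↔ k ∈ Ioo (kminus L) (kplus L)) ∧
      -- the asymptotic expansions of its end points
      (fun L : ℝ => kminus L - (1 - 8 * Real.exp (-2 * L)))
        =O[atTop] (fun L : ℝ => L * Real.exp (-4 * L)) ∧
      (fun L : ℝ => kplus L - (1 + 8 * Real.exp (-2 * L)))
        =O[atTop] (fun L : ℝ => L * Real.exp (-4 * L)) ∧
      -- the expansions of the boundary values and of their derivatives, uniformly in `k`
      ∃ C L₀ : ℝ, ∀ L : ℝ, L₀ ≤ L → ∀ k ∈ Ioo (kminus L) (kplus L),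
        |boundaryValue L k - (2 * Real.exp (-L) - 1 / 4 * (k - 1) * Real.exp L)|
          ≤ C * L * Real.exp (-3 * L) ∧
        |boundarySlope L k - (-2 * Real.exp (-L) - 1 / 4 * (k - 1) * Real.exp L)|
          ≤ C * L * Real.exp (-3 * L) ∧
        |deriv (boundaryValue L) k - (-(1 / 4) * Real.exp L)| ≤ C * L * Real.exp (-L) ∧
        |deriv (boundarySlope L) k - (-(1 / 4) * Real.exp L)| ≤ C * L * Real.exp (-L) := by
  refine ⟨fun L hL => ⟨fun k hk => ⟨?_, dnSolution_zero hk⟩, dtnBranch_eq_image hL⟩,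
    fun L hL => ⟨contDiffOn_boundaryValue hL.le, contDiffOn_boundarySlope hL.le⟩,
    bumpLeft, bumpRight, fun L hL => ⟨bumpLeft_nonneg L,
      (one_mem_Ioo_bump hL).1.trans (one_mem_Ioo_bump hL).2, bumpRight_le L,
      fun k hk => isSingleBump_iff_mem_Ioo hL hk⟩, ?_⟩
  · rw [deriv_dnSolution hk]
    exact isNeumannSolution_dnSolution hk L
  obtain ⟨C, -, hC⟩ := eventually_bump_expansion
  obtain ⟨D, -, hD⟩ := eventually_boundary_expansion
  have exp_three : ∀ L : ℝ, Real.exp (-3 * L) = Real.exp (-L) ^ 3 := fun L => by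
    rw [← Real.exp_nat_mul]; ring_nf
  have exp_four : ∀ L : ℝ, Real.exp (-4 * L) = Real.exp (-L) ^ 4 := fun L => by
    rw [← Real.exp_nat_mul]; ring_nf
  simp only [exp_neg_two_mul, exp_three, exp_four]
  refine ⟨?_, ?_, ?_⟩
  · refine Asymptotics.IsBigO.of_bound C ?_
    filter_upwards [hC, eventually_ge_atTop 0] with L h hL
    rw [Real.norm_eq_abs, Real.norm_of_nonneg (by positivity), ← mul_assoc]
    exact h.1
  · refine Asymptotics.IsBigO.of_bound C ?_
    filter_upwards [hC, eventually_ge_atTop 0] with L h hL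
    rw [Real.norm_eq_abs, Real.norm_of_nonneg (by positivity), ← mul_assoc]
    exact h.2.1
  · obtain ⟨L₀, hL₀⟩ := eventually_atTop.1 (hC.and (hD.and (eventually_ge_atTop 0)))
    refine ⟨D, L₀, fun L hL k hk => ?_⟩
    obtain ⟨hCL, hDL, h0⟩ := hL₀ L hL
    obtain ⟨hmem, h1, h2, h3, h4⟩ := hDL k (hCL.2.2 k hk)
    rw [(hasDerivAt_boundaryValue hmem h0).deriv, (hasDerivAt_boundarySlope hmem h0).deriv,
      boundarySlope_eq hmem, neg_mul (1 / 4 : ℝ), sub_neg_eq_add, sub_neg_eq_add]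
    exact ⟨h1, h2, h3, h4⟩
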